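/- Let $d\ge 2$, $\lambda>0$, $v>0$, and let $F$ be a probability distribution on $[0,\infty)$, with distribution function also denoted by $F$, such that $$\int_0^\infty (1-F(s))^{1/d}\,ds<\infty .$$ Let $\{p_i : i\in\mathbb{N}\}$ be a homogeneous Poisson point process (the target locations) with intensity $\lambda$ on $\mathbb{R}^d=\mathbb{R}\times\mathbb{R}^{d-1}$, and let each target $p_i$ carry a reward $r(p_i)\ge 0$, where the rewards are independent of each other and of the locations and have distribution $F$. For $L>0$ let $\Pi(L)$ be the set of feasible paths that start from the origin and travel a distance $L$ in the longitudinal direction, that is, the paths $x=(x_1,x_2):[0,L/v]\to\mathbb{R}\times\mathbb{R}^{d-1}$ with $x(0)=0$ and $$\dot x_1(t)=v,\qquad \dot x_2(t)=u(t),\qquad |u(t)|\le v,$$ for some measurable control $u$, where $|\cdot|$ is the Euclidean norm and the equations hold in the integrated sense $x_1(t)=vt$, $x_2(t)=\int_0^t u(s)\,ds$. Let $$T^*_d(L)=\sup_{\pi\in\Pi(L)}\ \sum_{i\,:\,p_i\in\pi} r(p_i),\qquad R^*_d(L)=\frac{T^*_d(L)}{L}.$$ Then $T^*_d(L)$ is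 (almost everywhere) measurable for every $L>0$, and the optimal mean reward $\mathbf{R}^*_d:=\sup_{L>0}\mathbb{E}[T^*_d(L)]/L$ is finite and is the limit of the expected mean reward: there is a finite constant $c\ge 0$ such that $$\mathbf{R}^*_d=\lim_{L\to\infty}\mathbb{E}[R^*_d(L)]=\lim_{L\to\infty}\frac{\mathbb{E}[T^*_d(L)]}{L}=c .$$ -/

import Mathlib

open MeasureTheory ProbabilityTheory Filter Topology
open scoped ENNReal NNReal

/-- The `d`-dimensional position space: the first factor is the longitudinal axis, the second
factor holds the `d - 1` lateral coordinates. For `d = 2` this is the plane. -/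
abbrev RewardSpace (d : ℕ) : Type := ℝ × EuclideanSpace ℝ (Fin (d - 1))

/-- The number (possibly infinite) of points of the sequence `p` that lie in `A`. -/
noncomputable def pointCount {d : ℕ} (p : ℕ → RewardSpace d) (A : Set (RewardSpace d)) : ℕ∞ :=
  {i : ℕ | p i ∈ A}.encard

/-- The random points `p 0, p 1, …` form a homogeneous Poisson point process with intensity `lam`:
they are almost surely pairwise distinct, the number of points in a measurable set `A` of finite
volume `|A|` is Poisson with parameter `lam * |A|`, and the numbers of points in pairwise disjoint
measurable sets are independent. -/
structure IsPoissonProcess {Ω : Type*} [MeasurableSpace Ω] (P : Measure Ω) {d : ℕ} (lam : ℝ≥0)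
    (p : ℕ → Ω → RewardSpace d) : Prop where
  measurable : ∀ i, Measurable (p i)
  injective : ∀ᵐ ω ∂P, Function.Injective fun i => p i ω
  poisson : ∀ A : Set (RewardSpace d), MeasurableSet A → volume A ≠ ∞ → ∀ k : ℕ,
    P {ω | pointCount (fun i => p i ω) A = k}
      = poissonMeasure (lam * (volume A).toNNReal) {k}
  indep : ∀ (n : ℕ) (A : Fin n → Set (RewardSpace d)), (∀ j, MeasurableSet (A j)) →
    Pairwise (fun j k => Disjoint (A j) (A k)) →
    iIndepFun (fun j ω => pointCount (fun i => p i ω) (A j)) P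

/-- A Poisson reward field: the target locations `p i` form a Poisson point process of intensity
`lam`, and the target at `p i` carries the nonnegative reward `r i`. The rewards are independent of
each other and of the locations, and each of them has law `F`. -/
structure IsPoissonRewardField {Ω : Type*} [MeasurableSpace Ω] (P : Measure Ω) {d : ℕ} (lam : ℝ≥0)
    (F : Measure ℝ) (p : ℕ → Ω → RewardSpace d) (r : ℕ → Ω → ℝ) : Prop where
  locations : IsPoissonProcess P lam p
  measurable : ∀ i, Measurable (r i)
  nonneg : ∀ i ω, 0 ≤ r i ω
  law : ∀ i, P.map (r i) = F
  indep : iIndepFun r P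
  indep_locations : IndepFun (fun ω i => p i ω) (fun ω i => r i ω) P

/-- The feasible paths `x = (x₁, x₂)` that start from the origin and travel a distance `L` in the
longitudinal direction: on the time interval `[0, L / v]` the path solves `x₁' = v`, `x₂' = u`
with a measurable control `u` such that `|u| ≤ v` (speed `v`, unit agility). -/
def feasiblePaths (d : ℕ) (v L : ℝ) : Set (ℝ → RewardSpace d) :=
  {x | ∃ u : ℝ → EuclideanSpace ℝ (Fin (d - 1)), Measurable u ∧
    (∀ t ∈ Set.Icc 0 (L / v), ‖u t‖ ≤ v) ∧
    ∀ t ∈ Set.Icc 0 (L / v), x t = (v * t, ∫ s in (0 : ℝ)..t, u s)}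

open Classical in
/-- The total reward of the targets visited by the path `x` during the time interval `[0, τ]`. -/
noncomputable def collectedReward {d : ℕ} (p : ℕ → RewardSpace d) (r : ℕ → ℝ) (τ : ℝ)
    (x : ℝ → RewardSpace d) : ℝ≥0∞ :=
  ∑' i, if ∃ t ∈ Set.Icc 0 τ, x t = p i then ENNReal.ofReal (r i) else 0

/-- The optimal total reward `T*(L)` for the realization `(p, r)` of the targets: the supremum of
the collected reward over all feasible paths (unlimited sensing range). -/
noncomputable def optimalReward {d : ℕ} (v : ℝ) (p : ℕ → RewardSpace d) (r : ℕ → ℝ) (L : ℝ) :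
    ℝ≥0∞ :=
  ⨆ x ∈ feasiblePaths d v L, collectedReward p r (L / v) x

/-- The optimal mean reward `R*(L) = T*(L) / L`. -/
noncomputable def optimalMeanReward {d : ℕ} (v : ℝ) (p : ℕ → RewardSpace d) (r : ℕ → ℝ) (L : ℝ) :
    ℝ≥0∞ :=
  optimalReward v p r L / ENNReal.ofReal L

/-! Dividing time by `v` turns feasibility into a preorder: `b` is reachable from `a` iff it lies in
the forward cone (`ConeLE`). Hence T*(L) is the largest reward of a finite chain in a truncated cone
(`optimalReward_eq_chainReward`). This is a countable supremum of measurable functions, and `v` has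
disappeared from it.

Let a(L) be its mean. A chain over [0, L] can be prolonged by any chain starting from its endpoint.
The targets beyond L are independent of that endpoint, and by translation invariance the best
continuation of length M has mean a(M) wherever it starts. So a is superadditive
(`IsPoissonRewardField.superadditive`), and Fekete's lemma (`tendsto_div_of_superadditive`) makes
a(L)/L converge to its supremum. Independence enters through an explicit formula for expectations of
functionals of the targets in two disjoint bounded regions
(`IsPoissonRewardField.lintegral_eq_poissonExpect₂`), which turns conditioning into an iterated
integral.

Finiteness needs a(L) ≤ K L. Write each reward as the integral over s of the indicator that it
exceeds s, fix s and let q = F(s, ∞). All paths are covered by 3^((d-1)(n-1)) tubes around lattice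
walks of mesh L/n. The number of targets with reward above s in one tube has an explicit exponential
moment, so a union bound controls the mean of the maximum by a multiple of (n-1) + n λ q (L/n)^d.
Taking n close to L (λ q)^(1/d) gives C L q^(1/d), and integrating over s uses exactly the
hypothesis on `F`. -/

/-! ### Reachability by forward cones, and the reduction from paths to chains. -/

/-- The point `b` can be reached from `a`: it lies in the forward cone of `a`. -/
def ConeLE {d : ℕ} (a b : RewardSpace d) : Prop := ‖b.2 - a.2‖ ≤ b.1 - a.1

theorem ConeLE.trans {d : ℕ} {a b c : RewardSpace d} (hab : ConeLE a b) (hbc : ConeLE b c) :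
    ConeLE a c := by
  unfold ConeLE at *
  calc ‖c.2 - a.2‖ = ‖(c.2 - b.2) + (b.2 - a.2)‖ := by congr 1; abel
    _ ≤ ‖c.2 - b.2‖ + ‖b.2 - a.2‖ := norm_add_le _ _
    _ ≤ c.1 - a.1 := by linarith

theorem ConeLE.fst_le {d : ℕ} {a b : RewardSpace d} (hab : ConeLE a b) : a.1 ≤ b.1 := by
  unfold ConeLE at hab
  linarith [norm_nonneg (b.2 - a.2)]

/-- The targets with indices in `S` form a chain in the forward cone of `z`, within longitudinal
distance `L` from `z`. -/
def IsAdmissible {d : ℕ} {ι : Type*} (z : RewardSpace d) (L : ℝ) (x : ι → RewardSpace d)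
    (S : Finset ι) : Prop :=
  (∀ i ∈ S, ConeLE z (x i) ∧ (x i).1 ≤ z.1 + L) ∧
    ∀ i ∈ S, ∀ j ∈ S, ConeLE (x i) (x j) ∨ ConeLE (x j) (x i)

/-- The largest total reward of an admissible chain of targets. -/
noncomputable def chainReward {d : ℕ} {ι : Type*} (z : RewardSpace d) (L : ℝ)
    (x : ι → RewardSpace d) (ρ : ι → ℝ) : ℝ≥0∞ :=
  ⨆ (S : Finset ι) (_ : IsAdmissible z L x S), ∑ i ∈ S, ENNReal.ofReal (ρ i)

theorem le_chainReward {d : ℕ} {ι : Type*} {z : RewardSpace d} {L : ℝ}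
    {x : ι → RewardSpace d} {ρ : ι → ℝ} {S : Finset ι} (hS : IsAdmissible z L x S) :
    ∑ i ∈ S, ENNReal.ofReal (ρ i) ≤ chainReward z L x ρ :=
  le_iSup₂_of_le S hS le_rfl

theorem feasiblePaths_coneLE {d : ℕ} {v L : ℝ} {x : ℝ → RewardSpace d}
    (hx : x ∈ feasiblePaths d v L) {s t : ℝ} (hs : 0 ≤ s) (hst : s ≤ t) (ht : t ≤ L / v) :
    ConeLE (x s) (x t) := by
  obtain ⟨u, hu, hb, hx⟩ := hx
  have hint : ∀ a b : ℝ, 0 ≤ a → a ≤ b → b ≤ L / v → IntervalIntegrable u volume a b := by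
    intro a b ha hab hbL
    rw [intervalIntegrable_iff_integrableOn_Icc_of_le hab]
    refine Measure.integrableOn_of_bounded (M := v) (by simp) hu.aestronglyMeasurable ?_
    filter_upwards [ae_restrict_mem measurableSet_Icc] with r hr
    exact hb r ⟨ha.trans hr.1, hr.2.trans hbL⟩
  unfold ConeLE
  rw [hx s ⟨hs, hst.trans ht⟩, hx t ⟨hs.trans hst, ht⟩]
  dsimp only
  rw [intervalIntegral.integral_interval_sub_left (hint 0 t le_rfl (hs.trans hst) ht)
    (hint 0 s le_rfl hs (hst.trans ht))]
  have := intervalIntegral.norm_integral_le_of_norm_le_const (a := s) (b := t) (C := v) (f := u)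
    (fun r hr => by
      rw [Set.uIoc_of_le hst] at hr
      exact hb r ⟨hs.trans hr.1.le, hr.2.trans ht⟩)
  rw [abs_of_nonneg (by linarith)] at this
  linarith

/-- Join the targets in longitudinal order at constant velocity; the cone condition says that each
such velocity has norm at most `v`. The endpoint `q` is kept arbitrary so that, in the induction,
the furthest target can serve as the endpoint for the others. -/
theorem exists_control {d : ℕ} {ι : Type*} {v : ℝ} (hv : 0 < v) (x : ι → RewardSpace d)
    (S : Finset ι) :
    ∀ q : RewardSpace d, (∀ i ∈ S, ConeLE 0 (x i) ∧ ConeLE (x i) q) → ConeLE 0 q →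
    (∀ i ∈ S, ∀ j ∈ S, ConeLE (x i) (x j) ∨ ConeLE (x j) (x i)) →
    ∃ u : ℝ → EuclideanSpace ℝ (Fin (d - 1)), Measurable u ∧ (∀ t, ‖u t‖ ≤ v) ∧
      (∀ i ∈ S, ∫ s in (0 : ℝ)..((x i).1 / v), u s = (x i).2) ∧
      ∫ s in (0 : ℝ)..(q.1 / v), u s = q.2 := by
  classical
  have key : ∀ a b : RewardSpace d, ConeLE a b → ∃ w : EuclideanSpace ℝ (Fin (d - 1)),
      ‖w‖ ≤ v ∧ (b.1 / v - a.1 / v) • w = b.2 - a.2 := by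
    intro a b hab
    have h1 := hab
    unfold ConeLE at h1
    rcases (hab.fst_le).eq_or_lt with h | h
    · refine ⟨0, by simpa using hv.le, ?_⟩
      have : ‖b.2 - a.2‖ ≤ 0 := by linarith
      rw [norm_le_zero_iff] at this
      simp [this]
    · have hp : 0 < b.1 - a.1 := by linarith
      refine ⟨(v / (b.1 - a.1)) • (b.2 - a.2), ?_, ?_⟩
      · rw [norm_smul, Real.norm_of_nonneg (by positivity), div_mul_eq_mul_div, div_le_iff₀ hp]
        gcongr
      · rw [smul_smul]
        have : (b.1 / v - a.1 / v) * (v / (b.1 - a.1)) = 1 := by field_simp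
        rw [this, one_smul]
  induction S using Finset.induction_on_max_value (fun i => (x i).1) with
  | empty =>
    intro q _ hq _
    obtain ⟨w, hw, hw'⟩ := key 0 q hq
    refine ⟨fun _ => w, measurable_const, fun _ => hw, by simp, ?_⟩
    simpa using hw'
  | insert a S haS hmax ih =>
    intro q hS hq hchain
    have hle : ∀ i ∈ S, ConeLE (x i) (x a) := by
      intro i hi
      rcases hchain i (by simp [hi]) a (by simp) with h | h
      · exact h
      -- The reversed cone relation together with maximality of `x a` forces the two points to
      -- coincide.
      · have h1 := hmax i hi
        unfold ConeLE at h ⊢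
        rw [norm_sub_rev]
        linarith
    obtain ⟨u, hu, hb, hi, ha⟩ := ih (x a) (fun i hi => ⟨(hS i (by simp [hi])).1, hle i hi⟩)
      (hS a (by simp)).1 (fun i hi j hj => hchain i (by simp [hi]) j (by simp [hj]))
    obtain ⟨w, hw, hw'⟩ := key (x a) q (hS a (by simp)).2
    have h0a : 0 ≤ (x a).1 / v := div_nonneg (hS a (by simp)).1.fst_le hv.le
    have haq : (x a).1 / v ≤ q.1 / v := by gcongr; exact (hS a (by simp)).2.fst_le
    set u' : ℝ → EuclideanSpace ℝ (Fin (d - 1)) := fun t => if t ≤ (x a).1 / v then u t else w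
      with hu'def
    have hu' : Measurable u' := Measurable.ite measurableSet_Iic hu measurable_const
    have hb' : ∀ t, ‖u' t‖ ≤ v := by
      intro t
      by_cases h : t ≤ (x a).1 / v
      · simpa [u', h] using hb t
      · simpa [u', h] using hw
    have hint : ∀ a b : ℝ, IntervalIntegrable u' volume a b := by
      intro a b
      rw [intervalIntegrable_iff]
      exact Measure.integrableOn_of_bounded (M := v) (by simp [Set.uIoc]) hu'.aestronglyMeasurable
        (ae_of_all _ hb')
    have hold : ∀ t, 0 ≤ t → t ≤ (x a).1 / v →
        ∫ s in (0 : ℝ)..t, u' s = ∫ s in (0 : ℝ)..t, u s := by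
      intro t h0 ht
      refine intervalIntegral.integral_congr fun s hs => ?_
      rw [Set.uIcc_of_le h0] at hs
      simp [u', hs.2.trans ht]
    have hold_a : ∫ s in (0 : ℝ)..((x a).1 / v), u' s = (x a).2 := by rw [hold _ h0a le_rfl, ha]
    refine ⟨u', hu', hb', ?_, ?_⟩
    · intro i hiS
      rcases Finset.mem_insert.1 hiS with rfl | hiS'
      · exact hold_a
      · rw [hold _ (div_nonneg (hS i hiS).1.fst_le hv.le)
          (by gcongr; exact (hle i hiS').fst_le), hi i hiS']
    · rw [← intervalIntegral.integral_add_adjacent_intervals (hint 0 ((x a).1 / v))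
        (hint ((x a).1 / v) (q.1 / v)), hold_a]
      have : ∫ s in ((x a).1 / v)..(q.1 / v), u' s = ∫ s in ((x a).1 / v)..(q.1 / v), w := by
        refine intervalIntegral.integral_congr_ae (ae_of_all _ fun s hs => ?_)
        rw [Set.uIoc_of_le haq] at hs
        simp [u', hs.1]
      rw [this, intervalIntegral.integral_const, hw']
      abel

theorem optimalReward_eq_chainReward {d : ℕ} {v L : ℝ} (hv : 0 < v) (hL : 0 < L)
    (p : ℕ → RewardSpace d) (r : ℕ → ℝ) : optimalReward v p r L = chainReward 0 L p r := by
  classical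
  apply le_antisymm
  · refine iSup₂_le fun x hx => ?_
    unfold collectedReward
    rw [ENNReal.tsum_eq_iSup_sum]
    refine iSup_le fun s => ?_
    rw [← Finset.sum_filter]
    refine le_chainReward ⟨?_, ?_⟩
    · intro i hi
      obtain ⟨t, ht, hxt⟩ := (Finset.mem_filter.1 hi).2
      have h0 := feasiblePaths_coneLE hx le_rfl ht.1 ht.2
      obtain ⟨u, -, -, hu⟩ := hx
      have hx0 : x 0 = 0 := by
        rw [hu 0 ⟨le_rfl, by positivity⟩]
        simp
      rw [hx0, hxt] at h0
      refine ⟨h0, ?_⟩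
      rw [← hxt, hu t ht]
      have := (le_div_iff₀ hv).1 ht.2
      simp
      linarith
    · intro i hi j hj
      obtain ⟨t, ht, hxt⟩ := (Finset.mem_filter.1 hi).2
      obtain ⟨t', ht', hxt'⟩ := (Finset.mem_filter.1 hj).2
      rw [← hxt, ← hxt']
      rcases le_total t t' with h | h
      · exact Or.inl (feasiblePaths_coneLE hx ht.1 h ht'.2)
      · exact Or.inr (feasiblePaths_coneLE hx ht'.1 h ht.2)
  · refine iSup₂_le fun S hS => ?_
    have hfst : ∀ i ∈ S, (p i).1 ≤ L := fun i hi => by simpa using (hS.1 i hi).2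
    -- The endpoint is a dummy: a target of the chain has lateral norm at most its longitudinal
    -- coordinate, itself at most `L`, so `(2 * L, 0)` lies in its cone.
    obtain ⟨u, hu, hb, hi, -⟩ := exists_control hv p S ((2 * L, 0) : RewardSpace d)
      (fun i hi => ⟨(hS.1 i hi).1, by
        have h1 := (hS.1 i hi).1
        have h2 := hfst i hi
        simp only [ConeLE, Prod.fst_zero, Prod.snd_zero, sub_zero, zero_sub, norm_neg] at h1 ⊢
        linarith⟩) (by simp [ConeLE]; linarith) hS.2
    refine le_iSup₂_of_le (fun t => (v * t, ∫ s in (0 : ℝ)..t, u s))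
      ⟨u, hu, fun t _ => hb t, fun t _ => rfl⟩ ?_
    unfold collectedReward
    refine le_trans (Finset.sum_le_sum fun i hiS => ?_) (ENNReal.sum_le_tsum S)
    rw [if_pos]
    refine ⟨(p i).1 / v, ⟨div_nonneg (hS.1 i hiS).1.fst_le hv.le, ?_⟩, ?_⟩
    · gcongr
      exact hfst i hiS
    · dsimp only
      rw [hi i hiS, mul_div_cancel₀ _ hv.ne']

/-- Only targets in the truncated cone can enter a chain. With `e` an enumeration of the targets in
a bounded region, this replaces the infinite sequence by finitely many points, and it also shows
that their labelling is irrelevant. -/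
theorem chainReward_comp {d : ℕ} {ι κ : Type*} (z : RewardSpace d) (L : ℝ)
    (x : ι → RewardSpace d) (ρ : ι → ℝ) {e : κ → ι} (he : Function.Injective e)
    (hrange : ∀ j, ConeLE z (x j) → (x j).1 ≤ z.1 + L → j ∈ Set.range e) :
    chainReward z L (x ∘ e) (ρ ∘ e) = chainReward z L x ρ := by
  classical
  apply le_antisymm
  · refine iSup₂_le fun S hS => ?_
    have : IsAdmissible z L x (S.map ⟨e, he⟩) := by
      constructor
      · intro i hi
        obtain ⟨j, hj, rfl⟩ := Finset.mem_map.1 hi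
        exact hS.1 j hj
      · intro i hi j hj
        obtain ⟨i', hi', rfl⟩ := Finset.mem_map.1 hi
        obtain ⟨j', hj', rfl⟩ := Finset.mem_map.1 hj
        exact hS.2 i' hi' j' hj'
    simpa using le_chainReward (ρ := ρ) this
  · refine iSup₂_le fun S hS => ?_
    obtain ⟨S', rfl⟩ : ∃ S' : Finset κ, S'.map ⟨e, he⟩ = S := by
      refine ⟨S.preimage e he.injOn, ?_⟩
      ext i
      simp only [Finset.mem_map, Finset.mem_preimage, Function.Embedding.coeFn_mk]
      refine ⟨by rintro ⟨j, hj, rfl⟩; exact hj, fun hi => ?_⟩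
      obtain ⟨j, rfl⟩ := hrange i (hS.1 i hi).1 (hS.1 i hi).2
      exact ⟨j, hi, rfl⟩
    have : IsAdmissible z L (x ∘ e) S' :=
      ⟨fun i hi => hS.1 (e i) (by simpa using hi),
        fun i hi j hj => hS.2 (e i) (by simpa using hi) (e j) (by simpa using hj)⟩
    simpa using le_chainReward (ρ := ρ ∘ e) this

theorem chainReward_sub {d : ℕ} {ι : Type*} (z : RewardSpace d) (L : ℝ)
    (x : ι → RewardSpace d) (ρ : ι → ℝ) :
    chainReward 0 L (fun i => x i - z) ρ = chainReward z L x ρ := by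
  unfold chainReward IsAdmissible ConeLE
  simp [add_comm]

/-- There are countably many finite index sets, and for each one admissibility is a finite list of
measurable inequalities. -/
theorem measurable_chainReward {d : ℕ} {ι : Type*} [Countable ι] (z : RewardSpace d) (L : ℝ) :
    Measurable fun q : (ι → RewardSpace d) × (ι → ℝ) => chainReward z L q.1 q.2 := by
  classical
  unfold chainReward
  refine Measurable.iSup fun S => ?_
  have hm : MeasurableSet {q : (ι → RewardSpace d) × (ι → ℝ) | IsAdmissible z L q.1 S} := by
    unfold IsAdmissible ConeLE
    have hle : ∀ {f g : (ι → RewardSpace d) × (ι → ℝ) → ℝ}, Measurable f → Measurable g →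
      MeasurableSet {q | f q ≤ g q} := fun hf hg => measurableSet_le hf hg
    have h : ∀ i, Measurable fun q : (ι → RewardSpace d) × (ι → ℝ) => q.1 i :=
      fun i => (measurable_pi_apply i).comp measurable_fst
    simp only [Set.ofPred_and, Set.ofPred_or, Set.ofPred_forall]
    refine MeasurableSet.inter ?_ ?_
    · refine MeasurableSet.iInter fun i => MeasurableSet.iInter fun _ => ?_
      refine (hle ?_ ?_).inter (hle ?_ ?_)
      · exact ((h i).snd.sub_const _).norm
      · exact (h i).fst.sub_const _
      · exact (h i).fst
      · exact measurable_const
    · refine MeasurableSet.iInter fun i => MeasurableSet.iInter fun _ =>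
        MeasurableSet.iInter fun j => MeasurableSet.iInter fun _ => ?_
      refine (hle ?_ ?_).union (hle ?_ ?_)
      · exact ((h j).snd.sub (h i).snd).norm
      · exact (h j).fst.sub (h i).fst
      · exact ((h i).snd.sub (h j).snd).norm
      · exact (h i).fst.sub (h j).fst
  have : (fun q : (ι → RewardSpace d) × (ι → ℝ) =>
      ⨆ (_ : IsAdmissible z L q.1 S), ∑ i ∈ S, ENNReal.ofReal (q.2 i)) =
      {q | IsAdmissible z L q.1 S}.indicator fun q => ∑ i ∈ S, ENNReal.ofReal (q.2 i) := by
    ext q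
    by_cases hq : IsAdmissible z L q.1 S <;> simp [hq, Set.indicator]
  rw [this]
  refine Measurable.indicator ?_ hm
  exact Finset.measurable_sum _ fun i _ =>
    ((measurable_pi_apply i).comp measurable_snd).ennreal_ofReal

theorem chainReward_mono_length {d : ℕ} {ι : Type*} (z : RewardSpace d) {L M : ℝ} (h : L ≤ M)
    (x : ι → RewardSpace d) (ρ : ι → ℝ) : chainReward z L x ρ ≤ chainReward z M x ρ :=
  iSup₂_le fun _ hS => le_chainReward ⟨fun i hi => ⟨(hS.1 i hi).1, by linarith [(hS.1 i hi).2]⟩,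
    hS.2⟩

/-- The point `z` sits straight ahead of the last target of `S`, at longitudinal coordinate `L`. The
order of quantifiers is the point: `z` depends on the first slab alone and is fixed before the
targets `y` of the second slab are given. -/
theorem exists_chainReward_concat {d : ℕ} {ι : Type*} {L : ℝ} (hL : 0 ≤ L)
    (x : ι → RewardSpace d) (ρ : ι → ℝ) {S : Finset ι} (hS : IsAdmissible 0 L x S) :
    ∃ z : RewardSpace d, z.1 = L ∧ ‖z.2‖ ≤ L ∧
      ∀ {κ : Type} (M : ℝ), 0 ≤ M → ∀ (y : κ → RewardSpace d) (η : κ → ℝ),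
        ∑ i ∈ S, ENNReal.ofReal (ρ i) + chainReward z M y η ≤
          chainReward 0 (L + M) (Sum.elim x y) (Sum.elim ρ η) := by
  classical
  obtain ⟨z, hz1, hz2, hz⟩ : ∃ z : RewardSpace d, z.1 = L ∧ ConeLE 0 z ∧
      ∀ i ∈ S, ConeLE (x i) z := by
    rcases S.eq_empty_or_nonempty with rfl | hne
    · exact ⟨(L, 0), rfl, by simpa [ConeLE] using hL, by simp⟩
    · obtain ⟨a, ha, hmax⟩ := S.exists_max_image (fun i => (x i).1) hne
      have haL : (x a).1 ≤ L := by simpa using (hS.1 a ha).2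
      have hz : ConeLE (x a) ((L, (x a).2) : RewardSpace d) := by simpa [ConeLE] using haL
      refine ⟨(L, (x a).2), rfl, (hS.1 a ha).1.trans hz, fun i hi => ConeLE.trans ?_ hz⟩
      rcases hS.2 i hi a ha with h | h
      · exact h
      · have h1 := hmax i hi
        unfold ConeLE at h ⊢
        rw [norm_sub_rev]
        linarith
  refine ⟨z, hz1, by simpa [ConeLE, hz1] using hz2, fun {κ} M hM y η => ?_⟩
  unfold chainReward
  rw [ENNReal.add_biSup' (p := fun S => IsAdmissible z M y S) ⟨∅, by simp [IsAdmissible]⟩]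
  refine iSup₂_le fun S' hS' => ?_
  have : IsAdmissible 0 (L + M) (Sum.elim x y) (S.disjSum S') := by
    constructor
    · rintro (i | j) h
      · have hi := Finset.inl_mem_disjSum.1 h
        refine ⟨(hS.1 i hi).1, ?_⟩
        have := (hS.1 i hi).2
        simp at this ⊢
        linarith
      · have hj := Finset.inr_mem_disjSum.1 h
        refine ⟨hz2.trans (hS'.1 j hj).1, ?_⟩
        have := (hS'.1 j hj).2
        simp at this ⊢
        linarith
    · rintro (i | i) hi (j | j) hj
      · exact hS.2 i (Finset.inl_mem_disjSum.1 hi) j (Finset.inl_mem_disjSum.1 hj)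
      · exact Or.inl ((hz i (Finset.inl_mem_disjSum.1 hi)).trans
          (hS'.1 j (Finset.inr_mem_disjSum.1 hj)).1)
      · exact Or.inr ((hz j (Finset.inl_mem_disjSum.1 hj)).trans
          (hS'.1 i (Finset.inr_mem_disjSum.1 hi)).1)
      · exact hS'.2 i (Finset.inr_mem_disjSum.1 hi) j (Finset.inr_mem_disjSum.1 hj)
  have h := le_chainReward (ρ := Sum.elim ρ η) this
  rwa [Finset.sum_disjSum] at h

/-! ### Janossy measures of the Poisson process. -/

theorem measurableSet_range_eq {d : ℕ} {ι : Type*} (i : ι ↪ ℕ) {B : Set (RewardSpace d)}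
    (hB : MeasurableSet B) :
    MeasurableSet {q : ℕ → RewardSpace d | Set.range i = {j | q j ∈ B}} := by
  have : {q : ℕ → RewardSpace d | Set.range i = {j | q j ∈ B}} =
      ⋂ j, {q : ℕ → RewardSpace d | j ∈ Set.range i ↔ q j ∈ B} := by
    ext q
    simp [Set.ext_iff]
  rw [this]
  refine MeasurableSet.iInter fun j => ?_
  have hj : MeasurableSet {q : ℕ → RewardSpace d | q j ∈ B} := measurable_pi_apply j hB
  by_cases h : j ∈ Set.range i
  · simpa [h] using hj
  · simp only [h, false_iff]
    exact hj.compl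

theorem isAddHaarMeasure_volume_rewardSpace (d : ℕ) :
    (volume : Measure (RewardSpace d)).IsAddHaarMeasure := by
  rw [Measure.volume_eq_prod]
  infer_instance

theorem isAddHaarMeasure_volume_pi_rewardSpace (ι : Type*) [Fintype ι] (d : ℕ) :
    (volume : Measure (ι → RewardSpace d)).IsAddHaarMeasure := by
  have := isAddHaarMeasure_volume_rewardSpace d
  rw [volume_pi]
  exact Measure.pi.isAddHaarMeasure _

section Poisson

variable {Ω : Type*} [MeasurableSpace Ω] {P : Measure Ω} {d : ℕ}
  {lam : ℝ≥0} {p : ℕ → Ω → RewardSpace d}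

theorem IsPoissonProcess.measurable_seq (hp : IsPoissonProcess P lam p) :
    Measurable fun ω i => p i ω := measurable_pi_lambda _ hp.measurable

theorem IsPoissonProcess.measure_iInter_pointCount (hp : IsPoissonProcess P lam p)
    {κ : Type*} [Fintype κ] (A : κ → Set (RewardSpace d)) (hA : ∀ o, MeasurableSet (A o))
    (hdisj : Pairwise fun a b => Disjoint (A a) (A b)) (n : κ → ℕ∞) :
    P (⋂ o, {ω | pointCount (fun j => p j ω) (A o) = n o}) =
      ∏ o, P {ω | pointCount (fun j => p j ω) (A o) = n o} := by
  classical
  let e := Fintype.equivFin κ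
  have h := hp.indep (Fintype.card κ) (fun l => A (e.symm l)) (fun l => hA _)
    (fun a b hab => hdisj (e.symm.injective.ne hab))
  have h2 := (iIndepFun_iff_measure_inter_preimage_eq_mul.1 h) Finset.univ
    (sets := fun l => {n (e.symm l)}) (fun _ _ => MeasurableSet.of_discrete)
  simp only [Finset.mem_univ, Set.iInter_true] at h2
  rw [← Equiv.prod_comp e.symm, ← e.symm.surjective.iInter_comp]
  exact h2

/-- Since the sets `A l` are disjoint, at most one labelling `i` fits a given configuration. The
union of the events says that every `A l` holds exactly one point and the rest of `B` none, so its
probability is a product of Poisson masses. -/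
theorem IsPoissonProcess.tsum_measure_rectangle (hp : IsPoissonProcess P lam p)
    {ι : Type*} [Fintype ι] {B : Set (RewardSpace d)} (hB : MeasurableSet B)
    (hBfin : volume B ≠ ∞) (A : ι → Set (RewardSpace d)) (hA : ∀ l, MeasurableSet (A l))
    (hAB : ∀ l, A l ⊆ B) (hdisj : Pairwise fun a b => Disjoint (A a) (A b)) :
    ∑' i : ι ↪ ℕ, P {ω | Set.range i = {j | p j ω ∈ B} ∧ ∀ l, p (i l) ω ∈ A l} =
      ENNReal.ofReal (Real.exp (-(lam * (volume B).toReal))) * lam ^ Fintype.card ι *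
        ∏ l, volume (A l) := by
  classical
  have : Countable (ι ↪ ℕ) := DFunLike.coe_injective.countable
  have hmeas : ∀ i : ι ↪ ℕ,
      MeasurableSet {ω | Set.range i = {j | p j ω ∈ B} ∧ ∀ l, p (i l) ω ∈ A l} := by
    intro i
    refine (hp.measurable_seq (measurableSet_range_eq i hB)).inter ?_
    have : MeasurableSet (⋂ l, {ω | p (i l) ω ∈ A l}) :=
      MeasurableSet.iInter fun l => hp.measurable _ (hA l)
    rwa [← Set.ofPred_forall] at this
  rw [← measure_iUnion ?_ hmeas]
  swap
  · intro i i' hii'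
    refine Set.disjoint_left.2 fun ω h h' => hii' ?_
    ext l
    have hl : i l ∈ Set.range i' := by rw [h'.1, ← h.1]; exact ⟨l, rfl⟩
    obtain ⟨l', hl'⟩ := hl
    by_cases hll : l' = l
    · rw [← hl', hll]
    · have h1 := h'.2 l'
      rw [hl'] at h1
      exact (Set.disjoint_left.1 (hdisj hll) h1 (h.2 l)).elim
  -- The index `none` stands for the part of `B` outside all `A l`, which must contain no point.
  let A' : Option ι → Set (RewardSpace d) := fun o => o.elim (B \ ⋃ l, A l) A
  let n : Option ι → ℕ := fun o => o.elim 0 fun _ => 1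
  have hA' : ∀ o, MeasurableSet (A' o) := by
    rintro (_ | l)
    · exact hB.diff (MeasurableSet.iUnion hA)
    · exact hA l
  have hdisj' : Pairwise fun a b => Disjoint (A' a) (A' b) := by
    rintro (_ | a) (_ | b) hab
    · exact (hab rfl).elim
    · exact Set.disjoint_left.2 fun y hy hy' => hy.2 (Set.mem_iUnion.2 ⟨b, hy'⟩)
    · exact Set.disjoint_left.2 fun y hy hy' => hy'.2 (Set.mem_iUnion.2 ⟨a, hy⟩)
    · exact hdisj fun h => hab (by rw [h])
  have hunion : (⋃ o, A' o) = B := by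
    ext y
    rw [Set.mem_iUnion]
    constructor
    · rintro ⟨_ | l, h⟩
      · exact h.1
      · exact hAB l h
    · intro hy
      by_cases h : y ∈ ⋃ l, A l
      · obtain ⟨l, hl⟩ := Set.mem_iUnion.1 h
        exact ⟨some l, hl⟩
      · exact ⟨none, hy, h⟩
  have hfin : ∀ o, volume (A' o) ≠ ∞ := fun o =>
    ne_top_of_le_ne_top hBfin (measure_mono (hunion ▸ Set.subset_iUnion A' o))
  have hset : (⋃ i : ι ↪ ℕ, {ω | Set.range i = {j | p j ω ∈ B} ∧ ∀ l, p (i l) ω ∈ A l}) =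
      ⋂ o, {ω | pointCount (fun j => p j ω) (A' o) = (n o : ℕ∞)} := by
    ext ω
    simp only [Set.mem_iUnion, Set.mem_iInter, Set.mem_ofPred_eq]
    constructor
    · rintro ⟨i, hi, hiA⟩ (_ | l)
      · simp only [pointCount, A', n, Option.elim_none, Nat.cast_zero, Set.encard_eq_zero]
        refine Set.eq_empty_of_forall_notMem fun j hj => hj.2 ?_
        obtain ⟨l, rfl⟩ : j ∈ Set.range i := by rw [hi]; exact hj.1
        exact Set.mem_iUnion.2 ⟨l, hiA l⟩
      · simp only [pointCount, A', n, Option.elim_some, Nat.cast_one, Set.encard_eq_one]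
        refine ⟨i l, Set.eq_singleton_iff_unique_mem.2 ⟨hiA l, fun j hj => ?_⟩⟩
        obtain ⟨l', rfl⟩ : j ∈ Set.range i := by rw [hi]; exact hAB l hj
        by_contra hne
        have hll : l' ≠ l := fun h => hne (by rw [h])
        exact Set.disjoint_left.1 (hdisj hll) (hiA l') hj
    · intro h
      have h1 : ∀ l, ∃ j, {j | p j ω ∈ A l} = {j} := fun l => by
        simpa only [pointCount, A', n, Option.elim_some, Nat.cast_one, Set.encard_eq_one]
          using h (some l)
      have h0 : {j | p j ω ∈ A' none} = ∅ := by
        simpa only [pointCount, n, Option.elim_none, Nat.cast_zero, Set.encard_eq_zero]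
          using h none
      choose i hi using h1
      have hiA : ∀ l, p (i l) ω ∈ A l := fun l => by
        have : i l ∈ {j | p j ω ∈ A l} := by rw [hi]; rfl
        exact this
      have hinj : Function.Injective i := by
        intro a b hab
        by_contra hne
        refine Set.disjoint_left.1 (hdisj hne) (hiA a) ?_
        rw [hab]
        exact hiA b
      refine ⟨⟨i, hinj⟩, ?_, hiA⟩
      ext j
      simp only [Function.Embedding.coeFn_mk, Set.mem_range, Set.mem_ofPred_eq]
      constructor
      · rintro ⟨l, rfl⟩
        exact hAB l (hiA l)
      · intro hj
        by_cases hjA : p j ω ∈ ⋃ l, A l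
        · obtain ⟨l, hl⟩ := Set.mem_iUnion.1 hjA
          have : j ∈ {j | p j ω ∈ A l} := hl
          rw [hi] at this
          exact ⟨l, this.symm⟩
        · have : j ∈ {j | p j ω ∈ A' none} := ⟨hj, hjA⟩
          rw [h0] at this
          exact this.elim
  rw [hset, hp.measure_iInter_pointCount A' hA' hdisj' (fun o => (n o : ℕ∞))]
  simp_rw [fun o => hp.poisson (A' o) (hA' o) (hfin o) (n o), poissonMeasure_singleton]
  have hvol : volume B = ∑ o, volume (A' o) := by
    rw [← hunion, measure_iUnion hdisj' hA', tsum_fintype]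
  have hvol' : (volume B).toReal = ∑ o, (volume (A' o)).toReal := by
    rw [hvol, ENNReal.toReal_sum fun o _ => hfin o]
  rw [Fintype.prod_option]
  rw [hvol', Fintype.sum_option, mul_add, neg_add, Real.exp_add, Finset.mul_sum,
    ← Finset.sum_neg_distrib, Real.exp_sum, ENNReal.ofReal_mul (Real.exp_pos _).le,
    ENNReal.ofReal_prod_of_nonneg (fun _ _ => (Real.exp_pos _).le), mul_assoc, mul_assoc]
  congr 1
  · simp [n, ENNReal.coe_toNNReal_eq_toReal]
  · have : (lam : ℝ≥0∞) ^ Fintype.card ι = ∏ _l : ι, (lam : ℝ≥0∞) := by simp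
    rw [this, ← Finset.prod_mul_distrib, ← Finset.prod_mul_distrib]
    refine Finset.prod_congr rfl fun l _ => ?_
    simp only [n, Option.elim_some, pow_one, Nat.factorial_one, Nat.cast_one, div_one]
    rw [ENNReal.ofReal_mul (Real.exp_pos _).le]
    congr 1
    rw [ENNReal.ofReal_coe_nnreal, ENNReal.coe_mul, ENNReal.coe_toNNReal (hfin (some l))]
    rfl

/-- The Janossy measures of a Poisson process: given that `B` contains exactly `k` points, they are
distributed like `k` independent uniform points of `B`. -/
theorem IsPoissonProcess.sum_map_eq (hp : IsPoissonProcess P lam p)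
    {ι : Type*} [Fintype ι] {B : Set (RewardSpace d)} (hB : MeasurableSet B)
    (hBfin : volume B ≠ ∞) (hlam : lam ≠ 0) :
    Measure.sum (fun i : ι ↪ ℕ => (P.restrict {ω | Set.range i = {j | p j ω ∈ B}}).map
      fun ω l => p (i l) ω) =
      (ENNReal.ofReal (Real.exp (-(lam * (volume B).toReal))) * lam ^ Fintype.card ι) •
        Measure.pi fun _ : ι => (volume : Measure (RewardSpace d)).restrict B := by
  classical
  set c := ENNReal.ofReal (Real.exp (-(lam * (volume B).toReal))) * (lam : ℝ≥0∞) ^ Fintype.card ι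
    with hc
  have hc0 : c ≠ 0 := by
    refine mul_ne_zero ?_ (pow_ne_zero _ (by simpa using hlam))
    simp [Real.exp_pos]
  have hctop : c ≠ ∞ := ENNReal.mul_ne_top (by simp) (by simp)
  set μ := Measure.sum (fun i : ι ↪ ℕ =>
    (P.restrict {ω | Set.range i = {j | p j ω ∈ B}}).map fun ω l => p (i l) ω) with hμ
  have hE : ∀ i : ι ↪ ℕ, MeasurableSet {ω | Set.range i = {j | p j ω ∈ B}} := fun i =>
    hp.measurable_seq (measurableSet_range_eq i hB)
  have hpi : ∀ i : ι ↪ ℕ, Measurable fun ω l => p (i l) ω := fun i =>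
    measurable_pi_lambda _ fun l => hp.measurable _
  -- The rectangle formula needs disjoint sides. Products of pairwise disjoint basic open sets form
  -- a countable cover of the injective tuples, and two measures agreeing on the members of a
  -- countable cover agree on its union. It then remains to see that neither measure charges the
  -- diagonals.
  let 𝒰 : Set (ι → TopologicalSpace.countableBasis (RewardSpace d)) :=
    {U | Pairwise fun a b => Disjoint (U a : Set (RewardSpace d)) (U b)}
  let R : 𝒰 → Set (ι → RewardSpace d) := fun U => Set.univ.pi fun l => (U.1 l : Set _)
  have hcover : ∀ x : ι → RewardSpace d, Function.Injective x → x ∈ ⋃ U, R U := by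
    intro x hx
    obtain ⟨V, hV, hVd⟩ := (Set.finite_range x).t2_separation
    have hb : ∀ l, ∃ U ∈ TopologicalSpace.countableBasis (RewardSpace d), x l ∈ U ∧ U ⊆ V (x l) :=
      fun l => (TopologicalSpace.isBasis_countableBasis _).exists_subset_of_mem_open (hV (x l)).1
        (hV (x l)).2
    choose U hU hxU hUV using hb
    refine Set.mem_iUnion.2 ⟨⟨fun l => ⟨U l, hU l⟩, fun a b hab => ?_⟩, fun l _ => hxU l⟩
    exact (hVd ⟨a, rfl⟩ ⟨b, rfl⟩ (hx.ne hab)).mono (hUV a) (hUV b)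
  have hrestr : ∀ U, μ.restrict (R U) =
      (c • Measure.pi fun _ : ι => (volume : Measure (RewardSpace d)).restrict B).restrict
        (R U) := by
    intro U
    have hUm : ∀ l, MeasurableSet (U.1 l : Set (RewardSpace d)) := fun l =>
      (TopologicalSpace.isOpen_of_mem_countableBasis (U.1 l).2).measurableSet
    rw [Measure.restrict_smul, Measure.restrict_pi_pi]
    have h : Measure.pi (fun l : ι => ((volume : Measure (RewardSpace d)).restrict B).restrict
        (U.1 l : Set (RewardSpace d))) = c⁻¹ • μ.restrict (R U) := by
      refine Measure.pi_eq fun s hs => ?_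
      have hA := hp.tsum_measure_rectangle hB hBfin (fun l => s l ∩ U.1 l ∩ B)
        (fun l => ((hs l).inter (hUm l)).inter hB) (fun l => Set.inter_subset_right)
        (fun a b hab => (U.2 hab).mono (fun y hy => hy.1.2) (fun y hy => hy.1.2))
      have hμR : μ (Set.univ.pi s ∩ R U) = ∑' i : ι ↪ ℕ,
          P {ω | Set.range i = {j | p j ω ∈ B} ∧ ∀ l, p (i l) ω ∈ s l ∩ U.1 l ∩ B} := by
        have hm : MeasurableSet (Set.univ.pi s ∩ R U) :=
          (MeasurableSet.univ_pi hs).inter (MeasurableSet.univ_pi hUm)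
        rw [hμ, Measure.sum_apply _ hm]
        congr 1 with i
        rw [Measure.map_apply (hpi i) hm, Measure.restrict_apply (hpi i hm)]
        congr 1
        ext ω
        simp only [Set.mem_inter_iff, Set.mem_preimage, Set.mem_pi, Set.mem_univ, true_implies,
          Set.mem_ofPred_eq, R]
        constructor
        · rintro ⟨⟨h1, h2⟩, h3⟩
          refine ⟨h3, fun l => ⟨⟨h1 l, h2 l⟩, ?_⟩⟩
          have : i l ∈ {j | p j ω ∈ B} := by rw [← h3]; exact ⟨l, rfl⟩
          exact this
        · rintro ⟨h1, h2⟩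
          exact ⟨⟨fun l => (h2 l).1.1, fun l => (h2 l).1.2⟩, h1⟩
      rw [Measure.smul_apply, Measure.restrict_apply (MeasurableSet.univ_pi hs), hμR, hA,
        smul_eq_mul, ← hc, ← mul_assoc, ENNReal.inv_mul_cancel hc0 hctop, one_mul]
      refine Finset.prod_congr rfl fun l _ => ?_
      rw [Measure.restrict_apply (hs l), Measure.restrict_apply ((hs l).inter (hUm l))]
    rw [h, smul_smul, ENNReal.mul_inv_cancel hc0 hctop, one_smul]
  have hO := Measure.restrict_iUnion_congr.2 hrestr
  rw [Measure.restrict_eq_self_of_ae_mem, Measure.restrict_eq_self_of_ae_mem] at hO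
  · exact hO
  · refine Measure.ae_smul_measure ?_ c
    have h : ∀ a b : ι, a ≠ b → ∀ᵐ x ∂(Measure.pi fun _ : ι =>
        (volume : Measure (RewardSpace d)).restrict B), x a ≠ x b := by
      intro a b hab
      rw [← Measure.restrict_pi_pi]
      refine ae_restrict_of_ae ?_
      rw [← volume_pi]
      -- The diagonal x a = x b is a linear subspace, and it is proper because the longitudinal
      -- direction is nonzero in every dimension; hence it is Lebesgue null.
      let W : Submodule ℝ (ι → RewardSpace d) :=
        LinearMap.ker (LinearMap.proj (R := ℝ) (φ := fun _ : ι => RewardSpace d) a -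
          LinearMap.proj (R := ℝ) (φ := fun _ : ι => RewardSpace d) b)
      have hW : W ≠ ⊤ := by
        intro htop
        have h1 : (Pi.single a ((1, 0) : RewardSpace d) : ι → RewardSpace d) ∈ W := by
          rw [htop]; trivial
        simp [W, Pi.single_eq_of_ne hab.symm] at h1
      have := isAddHaarMeasure_volume_pi_rewardSpace ι d
      have h0 := Measure.addHaar_submodule (volume : Measure (ι → RewardSpace d)) W hW
      refine measure_mono_null (fun x hx => ?_) h0
      simpa [W, sub_eq_zero] using hx
    have h' : ∀ᵐ x ∂(Measure.pi fun _ : ι => (volume : Measure (RewardSpace d)).restrict B),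
        ∀ a b : ι, a ≠ b → x a ≠ x b :=
      ae_all_iff.2 fun a => ae_all_iff.2 fun b => ae_all_iff.2 fun hab => h a b hab
    filter_upwards [h'] with x hx
    exact hcover x fun a b hab => by_contra fun hne => hx a b hne hab
  · have h : ∀ a b : ι, a ≠ b → ∀ᵐ x ∂μ, x a ≠ x b := by
      intro a b hab
      rw [hμ]
      refine (ae_iff.2 ?_)
      have hm : MeasurableSet {x : ι → RewardSpace d | ¬ x a ≠ x b} := by
        simp only [ne_eq, not_not]
        exact measurableSet_eq_fun (measurable_pi_apply a) (measurable_pi_apply b)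
      rw [Measure.sum_apply _ hm]
      refine ENNReal.tsum_eq_zero.2 fun i => ?_
      rw [Measure.map_apply (hpi i) hm]
      refine Measure.absolutelyContinuous_of_le Measure.restrict_le_self ?_
      refine measure_mono_null (fun ω hω => ?_) (ae_iff.1 hp.injective)
      intro hinj
      simp only [ne_eq, not_not, Set.mem_preimage, Set.mem_ofPred_eq] at hω
      exact hab (i.injective (hinj hω))
    have h' : ∀ᵐ x ∂μ, ∀ a b : ι, a ≠ b → x a ≠ x b :=
      ae_all_iff.2 fun a => ae_all_iff.2 fun b => ae_all_iff.2 fun hab => h a b hab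
    filter_upwards [h'] with x hx
    exact hcover x fun a b hab => by_contra fun hne => hx a b hne hab

end Poisson

/-! ### Adding the rewards, and expectations as explicit series. -/

section Marked

variable {Ω : Type*} [MeasurableSpace Ω] {P : Measure Ω} [IsProbabilityMeasure P] {d : ℕ}
  {lam : ℝ≥0} {F : Measure ℝ} {p : ℕ → Ω → RewardSpace d}
  {r : ℕ → Ω → ℝ}

theorem IsPoissonRewardField.map_locations_rewards (h : IsPoissonRewardField P lam F p r)
    {ι : Type*} [Fintype ι] (i : ι ↪ ℕ) :
    P.map (fun ω => ((fun j => p j ω), fun l => r (i l) ω)) =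
      (P.map fun ω j => p j ω).prod (Measure.pi fun _ : ι => F) := by
  have hind : IndepFun (fun ω j => p j ω) (fun ω l => r (i l) ω) P :=
    h.indep_locations.comp (φ := id) (ψ := fun ρ : ℕ → ℝ => fun l => ρ (i l)) measurable_id
      (measurable_pi_lambda _ fun l => measurable_pi_apply _)
  have hr : Measurable fun ω l => r (i l) ω := measurable_pi_lambda _ fun l => h.measurable _
  rw [hind.map_prod_eq_prod_map_map h.locations.measurable_seq.aemeasurable hr.aemeasurable,
    (h.indep.precomp i.injective).map_fun_eq_pi_map fun l => (h.measurable _).aemeasurable]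
  simp_rw [h.law]

/-- For a fixed labelling `i` the rewards `r ∘ i` have product law and are independent of the
locations, which alone determine the event. Integrating them out first leaves a function of the
locations, to which the Janossy identity applies. -/
theorem IsPoissonRewardField.tsum_setLIntegral [IsProbabilityMeasure F]
    (h : IsPoissonRewardField P lam F p r)
    (hlam : lam ≠ 0) {ι : Type*} [Fintype ι] {B : Set (RewardSpace d)} (hB : MeasurableSet B)
    (hBfin : volume B ≠ ∞) (C : ι → Set (RewardSpace d)) (hC : ∀ l, MeasurableSet (C l))
    (hCB : ∀ l, C l ⊆ B) {g : (ι → RewardSpace d × ℝ) → ℝ≥0∞} (hg : Measurable g) :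
    ∑' i : ι ↪ ℕ, ∫⁻ ω in {ω | Set.range i = {j | p j ω ∈ B} ∧ ∀ l, p (i l) ω ∈ C l},
        g (fun l => (p (i l) ω, r (i l) ω)) ∂P =
      ENNReal.ofReal (Real.exp (-(lam * (volume B).toReal))) * lam ^ Fintype.card ι *
        ∫⁻ y, g y ∂(Measure.pi fun l : ι => (volume.restrict (C l)).prod F) := by
  classical
  have hzip : Measurable fun q : (ι → RewardSpace d) × (ι → ℝ) => fun l => (q.1 l, q.2 l) :=
    measurable_pi_lambda _ fun l => ((measurable_pi_apply l).comp measurable_fst).prodMk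
      ((measurable_pi_apply l).comp measurable_snd)
  set G : (ι → RewardSpace d) → ℝ≥0∞ := (Set.univ.pi C).indicator fun x =>
    ∫⁻ ρ, g (fun l => (x l, ρ l)) ∂(Measure.pi fun _ : ι => F) with hG
  have hG0 : Measurable fun x : ι → RewardSpace d =>
      ∫⁻ ρ, g (fun l => (x l, ρ l)) ∂(Measure.pi fun _ : ι => F) :=
    (hg.comp hzip).lintegral_prod_right'
  have hpiC : MeasurableSet (Set.univ.pi C) := MeasurableSet.univ_pi hC
  have hGm : Measurable G := hG0.indicator hpiC
  have hpi : ∀ i : ι ↪ ℕ, Measurable fun ω l => p (i l) ω := fun i =>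
    measurable_pi_lambda _ fun l => h.locations.measurable _
  have hterm : ∀ i : ι ↪ ℕ,
      ∫⁻ ω in {ω | Set.range i = {j | p j ω ∈ B} ∧ ∀ l, p (i l) ω ∈ C l},
        g (fun l => (p (i l) ω, r (i l) ω)) ∂P =
      ∫⁻ x, G x ∂((P.restrict {ω | Set.range i = {j | p j ω ∈ B}}).map
        fun ω l => p (i l) ω) := by
    intro i
    let E : Set (ℕ → RewardSpace d) :=
      {q | Set.range i = {j | q j ∈ B}} ∩ {q | ∀ l, q (i l) ∈ C l}
    have hE : MeasurableSet E := by
      refine (measurableSet_range_eq i hB).inter ?_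
      have : MeasurableSet (⋂ l, {q : ℕ → RewardSpace d | q (i l) ∈ C l}) :=
        MeasurableSet.iInter fun l => measurable_pi_apply (i l) (hC l)
      rwa [← Set.ofPred_forall] at this
    have hzi : Measurable fun q : (ℕ → RewardSpace d) × (ι → ℝ) =>
        g (fun l => (q.1 (i l), q.2 l)) :=
      hg.comp (measurable_pi_lambda _ fun l => ((measurable_pi_apply (i l)).comp
        measurable_fst).prodMk ((measurable_pi_apply l).comp measurable_snd))
    have hEm : MeasurableSet {q : (ℕ → RewardSpace d) × (ι → ℝ) | q.1 ∈ E} := measurable_fst hE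
    have hH := hzi.indicator hEm
    have hmeas : Measurable fun ω => ((fun j => p j ω), fun l => r (i l) ω) :=
      h.locations.measurable_seq.prodMk (measurable_pi_lambda _ fun l => h.measurable _)
    have hEω : MeasurableSet {ω | (fun j => p j ω) ∈ E} := h.locations.measurable_seq hE
    have hBω : MeasurableSet {ω | Set.range i = {j | p j ω ∈ B}} :=
      h.locations.measurable_seq (measurableSet_range_eq i hB)
    calc ∫⁻ ω in {ω | Set.range i = {j | p j ω ∈ B} ∧ ∀ l, p (i l) ω ∈ C l},
        g (fun l => (p (i l) ω, r (i l) ω)) ∂P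
        = ∫⁻ q, {q : (ℕ → RewardSpace d) × (ι → ℝ) | q.1 ∈ E}.indicator
            (fun q => g (fun l => (q.1 (i l), q.2 l))) q
            ∂(P.map (fun ω => ((fun j => p j ω), fun l => r (i l) ω))) := by
          rw [lintegral_map hH hmeas]
          exact (lintegral_indicator hEω _).symm
      _ = ∫⁻ ω, ∫⁻ ρ, {q : (ℕ → RewardSpace d) × (ι → ℝ) | q.1 ∈ E}.indicator
            (fun q => g (fun l => (q.1 (i l), q.2 l))) (fun j => p j ω, ρ)
            ∂(Measure.pi fun _ : ι => F) ∂P := by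
          rw [h.map_locations_rewards i, lintegral_prod _ hH.aemeasurable,
            lintegral_map hH.lintegral_prod_right' h.locations.measurable_seq]
      _ = ∫⁻ ω in {ω | Set.range i = {j | p j ω ∈ B}}, G (fun l => p (i l) ω) ∂P := by
          rw [← lintegral_indicator hBω]
          refine lintegral_congr fun ω => ?_
          by_cases h1 : Set.range i = {j | p j ω ∈ B}
          · by_cases h2 : ∀ l, p (i l) ω ∈ C l
            · simp [Set.indicator, E, hG, h1, h2]
            · simp [Set.indicator, E, hG, h1, h2]
          · simp [Set.indicator, E, h1]
      _ = _ := (lintegral_map hGm (hpi i)).symm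
  simp_rw [hterm]
  rw [← lintegral_sum_measure, h.locations.sum_map_eq hB hBfin hlam, lintegral_smul_measure,
    smul_eq_mul]
  congr 1
  rw [hG, lintegral_indicator hpiC, Measure.restrict_pi_pi]
  simp_rw [Measure.restrict_restrict (hC _), Set.inter_eq_left.2 (hCB _)]
  rw [← (measurePreserving_arrowProdEquivProdArrow (RewardSpace d) ℝ ι
    (fun l => volume.restrict (C l)) (fun _ => F)).symm.lintegral_comp hg,
    lintegral_prod _ (by
      exact (hg.comp (MeasurableEquiv.measurable _)).aemeasurable)]
  rfl

end Marked

/-- The expectation of a functional of the marked points in `B` of a Poisson reward field,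
obtained by conditioning on the number of points. -/
noncomputable def poissonExpect {d : ℕ} (lam : ℝ≥0) (F : Measure ℝ) (B : Set (RewardSpace d))
    (Φ : ∀ k : ℕ, (Fin k → RewardSpace d × ℝ) → ℝ≥0∞) : ℝ≥0∞ :=
  ∑' k : ℕ, ENNReal.ofReal (Real.exp (-(lam * (volume B).toReal))) * lam ^ k / (k.factorial) *
    ∫⁻ y, Φ k y ∂(Measure.pi fun _ : Fin k => (volume.restrict B).prod F)

/-- The source of the factorials in `poissonExpect`: summing over embeddings counts each
configuration once for every labelling of it. -/
theorem card_embedding_range_eq (n : ℕ) {S : Set ℕ} (hS : S.encard = n) :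
    ENat.card {i : Fin n ↪ ℕ // Set.range i = S} = n.factorial := by
  classical
  have hfin : S.Finite := Set.finite_of_encard_eq_coe hS
  have := hfin.fintype
  have hcard : Fintype.card S = n := by
    have := Set.encard_eq_coe_toFinset_card S
    rw [hS, Set.toFinset_card] at this
    exact_mod_cast this.symm
  let e0 : Fin n ≃ S := (finCongr hcard.symm).trans (Fintype.equivFin S).symm
  let e : {i : Fin n ↪ ℕ // Set.range i = S} ≃ (Fin n ≃ S) :=
    { toFun := fun i => (Equiv.ofInjective i.1 i.1.injective).trans (Equiv.setCongr i.2)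
      invFun := fun f => ⟨⟨fun a => (f a : ℕ), Subtype.val_injective.comp f.injective⟩, by
        ext j
        simp only [Function.Embedding.coeFn_mk, Set.mem_range]
        exact ⟨by rintro ⟨a, rfl⟩; exact (f a).2, fun hj => ⟨f.symm ⟨j, hj⟩, by simp⟩⟩⟩
      left_inv := fun i => by ext; rfl
      right_inv := fun f => by ext; rfl }
  rw [ENat.card_congr e, ENat.card_eq_coe_fintype_card, Fintype.card_equiv e0, Fintype.card_fin]

theorem card_embedding_sum_range_eq (m n : ℕ) {S T : Set ℕ} (hST : Disjoint S T)
    (hS : S.encard = m) (hT : T.encard = n) :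
    ENat.card {i : Fin m ⊕ Fin n ↪ ℕ // Set.range (fun l => i (Sum.inl l)) = S ∧
      Set.range (fun l => i (Sum.inr l)) = T} = (m.factorial * n.factorial : ℕ) := by
  let e : {i : Fin m ⊕ Fin n ↪ ℕ // Set.range (fun l => i (Sum.inl l)) = S ∧
      Set.range (fun l => i (Sum.inr l)) = T} ≃
      {i : Fin m ↪ ℕ // Set.range i = S} × {i : Fin n ↪ ℕ // Set.range i = T} :=
    { toFun := fun i => (⟨Function.Embedding.inl.trans i.1, i.2.1⟩,
        ⟨Function.Embedding.inr.trans i.1, i.2.2⟩)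
      invFun := fun ij => ⟨⟨Sum.elim ij.1.1 ij.2.1, ij.1.1.injective.sumElim ij.2.1.injective
        fun a b hab => Set.disjoint_left.1 hST (ij.1.2.subset ⟨a, rfl⟩)
          (ij.2.2.subset ⟨b, hab.symm⟩)⟩, ij.1.2, ij.2.2⟩
      left_inv := fun i => by
        ext l
        rcases l with l | l <;> rfl
      right_inv := fun ij => by
        ext <;> rfl }
  rw [ENat.card_congr e, ENat.card_prod, card_embedding_range_eq m hS,
    card_embedding_range_eq n hT]
  simp

section Expectation

variable {Ω : Type*} [MeasurableSpace Ω] {P : Measure Ω} {d : ℕ}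
  {lam : ℝ≥0} {F : Measure ℝ} {p : ℕ → Ω → RewardSpace d} {r : ℕ → Ω → ℝ}

theorem encard_range_fin {k : ℕ} {f : Fin k → ℕ} (hf : Function.Injective f) :
    (Set.range f).encard = k := by
  rw [← Set.image_univ, hf.encard_image, Set.encard_univ]
  simp

theorem IsPoissonProcess.measurableSet_pointCount_eq (hp : IsPoissonProcess P lam p)
    {B : Set (RewardSpace d)} (hB : MeasurableSet B) (k : ℕ) :
    MeasurableSet {ω | pointCount (fun j => p j ω) B = k} := by
  have : Countable (Fin k ↪ ℕ) := DFunLike.coe_injective.countable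
  have heq : {ω | pointCount (fun j => p j ω) B = k} =
      ⋃ i : Fin k ↪ ℕ, {ω | Set.range i = {j | p j ω ∈ B}} := by
    ext ω
    rw [Set.mem_iUnion]
    constructor
    · intro hω
      have hcard := card_embedding_range_eq k (S := {j | p j ω ∈ B}) hω
      have hne : ENat.card {i : Fin k ↪ ℕ // Set.range i = {j | p j ω ∈ B}} ≠ 0 := by
        rw [hcard]
        exact_mod_cast k.factorial_ne_zero
      rw [Ne, ENat.card_eq_zero_iff_empty, not_isEmpty_iff] at hne
      exact ⟨hne.some.1, hne.some.2⟩
    · rintro ⟨i, hi⟩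
      have := encard_range_fin i.injective
      rw [show Set.range i = {j | p j ω ∈ B} from hi] at this
      exact this
  rw [heq]
  exact MeasurableSet.iUnion fun i => hp.measurable_seq (measurableSet_range_eq i hB)

theorem IsPoissonProcess.ae_finite [IsProbabilityMeasure P] (hp : IsPoissonProcess P lam p) {B : Set (RewardSpace d)}
    (hB : MeasurableSet B) (hBfin : volume B ≠ ∞) :
    ∀ᵐ ω ∂P, ∃ k : ℕ, {j | p j ω ∈ B}.encard = k := by
  have hm := hp.measurableSet_pointCount_eq hB
  have h1 : P (⋃ k : ℕ, {ω | pointCount (fun j => p j ω) B = k}) = 1 := by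
    rw [measure_iUnion ?_ hm]
    · simp_rw [fun k => hp.poisson B hB hBfin k]
      have h := measure_iUnion (μ := poissonMeasure (lam * (volume B).toNNReal))
        (f := fun k : ℕ => {k}) (fun a b hab => by simpa using hab) (fun _ => .of_discrete)
      rw [← h, Set.iUnion_of_singleton, measure_univ]
    · intro a b hab
      refine Set.disjoint_left.2 fun ω ha hb => hab ?_
      have : (a : ℕ∞) = b := (Eq.symm ha).trans hb
      exact_mod_cast this
  have h2 := (prob_compl_eq_zero_iff (MeasurableSet.iUnion hm)).2 h1
  rw [ae_iff]
  refine measure_mono_null (fun ω hω => ?_) h2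
  intro hmem
  obtain ⟨k, hk⟩ := Set.mem_iUnion.1 hmem
  exact hω ⟨k, hk⟩

/-- Independence of disjoint regions in the form of an iterated expectation. The weights split
because the volumes add in the exponential and the numbers of points add in the power of `lam`. -/
theorem IsPoissonRewardField.lintegral_eq_poissonExpect₂ [IsProbabilityMeasure P] [IsProbabilityMeasure F]
    (h : IsPoissonRewardField P lam F p r) (hlam : lam ≠ 0) {B₁ B₂ : Set (RewardSpace d)}
    (hB₁ : MeasurableSet B₁) (hB₂ : MeasurableSet B₂) (hfin₁ : volume B₁ ≠ ∞)
    (hfin₂ : volume B₂ ≠ ∞) (hdisj : Disjoint B₁ B₂)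
    {Φ : ∀ k₁ k₂ : ℕ, (Fin k₁ ⊕ Fin k₂ → RewardSpace d × ℝ) → ℝ≥0∞}
    (hΦ : ∀ k₁ k₂, Measurable (Φ k₁ k₂)) {Y : Ω → ℝ≥0∞}
    (hY : ∀ ω k₁ k₂ (i : Fin k₁ ⊕ Fin k₂ ↪ ℕ),
      Set.range (fun l => i (Sum.inl l)) = {j | p j ω ∈ B₁} →
      Set.range (fun l => i (Sum.inr l)) = {j | p j ω ∈ B₂} →
      Y ω = Φ k₁ k₂ fun l => (p (i l) ω, r (i l) ω)) :
    ∫⁻ ω, Y ω ∂P = poissonExpect lam F B₁ fun k₁ y₁ => poissonExpect lam F B₂ fun k₂ y₂ =>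
      Φ k₁ k₂ (Sum.elim y₁ y₂) := by
  classical
  set B := B₁ ∪ B₂ with hBdef
  have hB : MeasurableSet B := hB₁.union hB₂
  have hBvol : volume B = volume B₁ + volume B₂ := measure_union hdisj hB₂
  have hBfin : volume B ≠ ∞ := by rw [hBvol]; exact ENNReal.add_ne_top.2 ⟨hfin₁, hfin₂⟩
  let C : ∀ k₁ k₂ : ℕ, Fin k₁ ⊕ Fin k₂ → Set (RewardSpace d) := fun _ _ =>
    Sum.elim (fun _ => B₁) (fun _ => B₂)
  have hC : ∀ k₁ k₂ l, MeasurableSet (C k₁ k₂ l) := by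
    rintro k₁ k₂ (l | l)
    exacts [hB₁, hB₂]
  have hCB : ∀ k₁ k₂ l, C k₁ k₂ l ⊆ B := by
    rintro k₁ k₂ (l | l)
    exacts [Set.subset_union_left, Set.subset_union_right]
  let E : ∀ k₁ k₂ : ℕ, (Fin k₁ ⊕ Fin k₂ ↪ ℕ) → Set Ω := fun k₁ k₂ i =>
    {ω | Set.range i = {j | p j ω ∈ B} ∧ ∀ l, p (i l) ω ∈ C k₁ k₂ l}
  have hEm : ∀ k₁ k₂ i, MeasurableSet (E k₁ k₂ i) := by
    intro k₁ k₂ i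
    refine (h.locations.measurable_seq (measurableSet_range_eq i hB)).inter ?_
    have : MeasurableSet (⋂ l, {ω | p (i l) ω ∈ C k₁ k₂ l}) :=
      MeasurableSet.iInter fun l => h.locations.measurable _ (hC _ _ l)
    rwa [← Set.ofPred_forall] at this
  have hE : ∀ k₁ k₂ i ω, ω ∈ E k₁ k₂ i ↔
      Set.range (fun l => i (Sum.inl l)) = {j | p j ω ∈ B₁} ∧
      Set.range (fun l => i (Sum.inr l)) = {j | p j ω ∈ B₂} := by
    intro k₁ k₂ i ω
    constructor
    · rintro ⟨h1, h2⟩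
      constructor
      · ext j
        constructor
        · rintro ⟨l, rfl⟩
          exact h2 (Sum.inl l)
        · intro hj
          obtain ⟨l | l, rfl⟩ : j ∈ Set.range i := by rw [h1]; exact Or.inl hj
          · exact ⟨l, rfl⟩
          · exact (Set.disjoint_left.1 hdisj hj (h2 (Sum.inr l))).elim
      · ext j
        constructor
        · rintro ⟨l, rfl⟩
          exact h2 (Sum.inr l)
        · intro hj
          obtain ⟨l | l, rfl⟩ : j ∈ Set.range i := by rw [h1]; exact Or.inr hj
          · exact (Set.disjoint_left.1 hdisj (h2 (Sum.inl l)) hj).elim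
          · exact ⟨l, rfl⟩
    · rintro ⟨h1, h2⟩
      constructor
      · ext j
        constructor
        · rintro ⟨l | l, rfl⟩
          · exact Or.inl (h1.subset ⟨l, rfl⟩)
          · exact Or.inr (h2.subset ⟨l, rfl⟩)
        · rintro (hj | hj)
          · obtain ⟨l, rfl⟩ := h1.superset hj
            exact ⟨_, rfl⟩
          · obtain ⟨l, rfl⟩ := h2.superset hj
            exact ⟨_, rfl⟩
      · rintro (l | l)
        · exact h1.subset ⟨l, rfl⟩
        · exact h2.subset ⟨l, rfl⟩
  let V : ∀ k₁ k₂ : ℕ, (Fin k₁ ⊕ Fin k₂ ↪ ℕ) → Ω → ℝ≥0∞ := fun k₁ k₂ i =>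
    (E k₁ k₂ i).indicator fun ω => Φ k₁ k₂ fun l => (p (i l) ω, r (i l) ω)
  have hV : ∀ k₁ k₂ i, Measurable (V k₁ k₂ i) := fun k₁ k₂ i =>
    ((hΦ k₁ k₂).comp (measurable_pi_lambda _ fun l =>
      (h.locations.measurable _).prodMk (h.measurable _))).indicator (hEm _ _ _)
  have hcount : ∀ k₁ k₂ : ℕ, Countable (Fin k₁ ⊕ Fin k₂ ↪ ℕ) := fun _ _ =>
    DFunLike.coe_injective.countable
  -- Almost surely the regions hold finitely many points, `n₁` and `n₂` say. Only the terms with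
  -- these sizes survive; they equal `Y ω` for each of the n₁! n₂! labellings, and dividing by that
  -- number leaves `Y ω`.
  have hYae : Y =ᵐ[P] fun ω => ∑' k₁ : ℕ, ∑' k₂ : ℕ,
      ((k₁.factorial : ℝ≥0∞)⁻¹ * (k₂.factorial : ℝ≥0∞)⁻¹) * ∑' i, V k₁ k₂ i ω := by
    filter_upwards [h.locations.ae_finite hB₁ hfin₁, h.locations.ae_finite hB₂ hfin₂]
      with ω ⟨n₁, hn₁⟩ ⟨n₂, hn₂⟩
    have hST : Disjoint {j | p j ω ∈ B₁} {j | p j ω ∈ B₂} :=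
      Set.disjoint_left.2 fun j h1 h2 => Set.disjoint_left.1 hdisj h1 h2
    have hzero : ∀ k₁ k₂, (k₁ ≠ n₁ ∨ k₂ ≠ n₂) → ∀ i, V k₁ k₂ i ω = 0 := by
      intro k₁ k₂ hne i
      refine Set.indicator_of_notMem (fun hmem => ?_) _
      obtain ⟨h1, h2⟩ := (hE k₁ k₂ i ω).1 hmem
      have e1 := encard_range_fin (i.injective.comp Sum.inl_injective)
      have e2 := encard_range_fin (i.injective.comp Sum.inr_injective)
      rw [show Set.range (⇑i ∘ Sum.inl) = _ from h1, hn₁] at e1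
      rw [show Set.range (⇑i ∘ Sum.inr) = _ from h2, hn₂] at e2
      have e1' : n₁ = k₁ := by exact_mod_cast e1
      have e2' : n₂ = k₂ := by exact_mod_cast e2
      rcases hne with hne | hne
      · exact hne e1'.symm
      · exact hne e2'.symm
    rw [tsum_eq_single n₁, tsum_eq_single n₂]
    rotate_left
    · intro k₂ hk
      simp [hzero _ _ (Or.inr hk)]
    · intro k₁ hk
      simp [hzero _ _ (Or.inl hk)]
    let J : Set (Fin n₁ ⊕ Fin n₂ ↪ ℕ) := {i | ω ∈ E n₁ n₂ i}
    have hVY : ∀ i, V n₁ n₂ i ω = J.indicator (fun _ => Y ω) i := by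
      intro i
      by_cases hi : ω ∈ E n₁ n₂ i
      · have hi' := (hE _ _ _ _).1 hi
        rw [Set.indicator_of_mem (show i ∈ J from hi), hY ω n₁ n₂ i hi'.1 hi'.2]
        exact Set.indicator_of_mem hi _
      · rw [Set.indicator_of_notMem (show i ∉ J from hi)]
        exact Set.indicator_of_notMem hi _
    have hJ : J = {i | Set.range (fun l => i (Sum.inl l)) = {j | p j ω ∈ B₁} ∧
        Set.range (fun l => i (Sum.inr l)) = {j | p j ω ∈ B₂}} := by
      ext i
      exact hE _ _ _ _
    have hJcard : ENat.card J = (n₁.factorial * n₂.factorial : ℕ) := by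
      rw [hJ]
      exact card_embedding_sum_range_eq n₁ n₂ hST hn₁ hn₂
    simp_rw [hVY]
    rw [← tsum_subtype, ENNReal.tsum_const, hJcard]
    have hf : ∀ n : ℕ, ((n.factorial : ℝ≥0∞))⁻¹ * n.factorial = 1 := fun n =>
      ENNReal.inv_mul_cancel (by exact_mod_cast n.factorial_ne_zero) (by simp)
    rw [← mul_assoc]
    have : (n₁.factorial : ℝ≥0∞)⁻¹ * (n₂.factorial : ℝ≥0∞)⁻¹ *
        (((n₁.factorial * n₂.factorial : ℕ) : ℕ∞) : ℝ≥0∞) = 1 := by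
      push_cast
      calc _ = ((n₁.factorial : ℝ≥0∞)⁻¹ * n₁.factorial) *
            ((n₂.factorial : ℝ≥0∞)⁻¹ * n₂.factorial) := by ring
        _ = 1 := by rw [hf, hf, one_mul]
    rw [this, one_mul]
  rw [lintegral_congr_ae hYae]
  have hint : ∀ k₁ k₂, ∑' i, ∫⁻ ω, V k₁ k₂ i ω ∂P =
      (ENNReal.ofReal (Real.exp (-(lam * (volume B₁).toReal))) * lam ^ k₁) *
      ((ENNReal.ofReal (Real.exp (-(lam * (volume B₂).toReal))) * lam ^ k₂) *
      ∫⁻ y₁, ∫⁻ y₂, Φ k₁ k₂ (Sum.elim y₁ y₂)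
        ∂(Measure.pi fun _ : Fin k₂ => (volume.restrict B₂).prod F)
        ∂(Measure.pi fun _ : Fin k₁ => (volume.restrict B₁).prod F)) := by
    intro k₁ k₂
    have h1 := h.tsum_setLIntegral hlam hB hBfin (C k₁ k₂) (hC k₁ k₂) (hCB k₁ k₂) (hΦ k₁ k₂)
    have h2 : ∀ i, ∫⁻ ω, V k₁ k₂ i ω ∂P = ∫⁻ ω in E k₁ k₂ i,
        Φ k₁ k₂ (fun l => (p (i l) ω, r (i l) ω)) ∂P := fun i =>
      lintegral_indicator (hEm _ _ _) _
    simp_rw [h2]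
    rw [h1, ← (measurePreserving_sumPiEquivProdPi_symm
      (fun l => (volume.restrict (C k₁ k₂ l)).prod F)).lintegral_comp (hΦ k₁ k₂),
      lintegral_prod _ (by
        exact ((hΦ k₁ k₂).comp (MeasurableEquiv.measurable _)).aemeasurable)]
    have hconst : ENNReal.ofReal (Real.exp (-(lam * (volume B).toReal))) *
        (lam : ℝ≥0∞) ^ Fintype.card (Fin k₁ ⊕ Fin k₂) =
        (ENNReal.ofReal (Real.exp (-(lam * (volume B₁).toReal))) * lam ^ k₁) *
        (ENNReal.ofReal (Real.exp (-(lam * (volume B₂).toReal))) * lam ^ k₂) := by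
      rw [hBvol, ENNReal.toReal_add hfin₁ hfin₂, mul_add, neg_add, Real.exp_add,
        ENNReal.ofReal_mul (Real.exp_pos _).le, Fintype.card_sum, Fintype.card_fin,
        Fintype.card_fin, pow_add]
      ring
    rw [hconst, mul_assoc]
    rfl
  have helim : ∀ k₁ k₂, Measurable fun y : (Fin k₁ → RewardSpace d × ℝ) ×
      (Fin k₂ → RewardSpace d × ℝ) => Φ k₁ k₂ (Sum.elim y.1 y.2) := fun k₁ k₂ =>
    (hΦ k₁ k₂).comp (measurable_pi_lambda _ fun l => by
      rcases l with l | l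
      · exact (measurable_pi_apply l).comp measurable_fst
      · exact (measurable_pi_apply l).comp measurable_snd)
  have hVs : ∀ k₁ k₂, Measurable fun ω => ((k₁.factorial : ℝ≥0∞)⁻¹ * (k₂.factorial : ℝ≥0∞)⁻¹) *
      ∑' i, V k₁ k₂ i ω := fun k₁ k₂ => (Measurable.tsum (hV k₁ k₂)).const_mul _
  rw [lintegral_tsum fun k₁ => (Measurable.tsum (hVs k₁)).aemeasurable]
  unfold poissonExpect
  refine tsum_congr fun k₁ => ?_
  have hsf : ∀ k, SFinite (Measure.pi fun _ : Fin k => (volume.restrict B₂).prod F) :=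
    fun k => by
      have := Measure.pi.sigmaFinite fun _ : Fin k => (volume.restrict B₂).prod F
      infer_instance
  have hinner : ∀ k₂, Measurable fun y₁ => ∫⁻ y₂, Φ k₁ k₂ (Sum.elim y₁ y₂)
        ∂(Measure.pi fun _ : Fin k₂ => (volume.restrict B₂).prod F) := fun k₂ =>
    (helim k₁ k₂).lintegral_prod_right'
  rw [lintegral_tsum fun k₂ => (hVs k₁ k₂).aemeasurable,
    lintegral_tsum fun k₂ => ((hinner k₂).const_mul _).aemeasurable, ← ENNReal.tsum_mul_left]
  refine tsum_congr fun k₂ => ?_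
  rw [lintegral_const_mul _ (Measurable.tsum (hV k₁ k₂)),
    lintegral_tsum fun i => (hV k₁ k₂ i).aemeasurable, hint, lintegral_const_mul _ (hinner k₂)]
  simp only [div_eq_mul_inv]
  ring

theorem poissonExpect_const [IsProbabilityMeasure F] {B : Set (RewardSpace d)}
    (hfin : volume B ≠ ∞) (a : ℝ≥0∞) : poissonExpect lam F B (fun _ _ => a) = a := by
  unfold poissonExpect
  have hB : ((volume.restrict B).prod F) Set.univ = volume B := by
    rw [← Set.univ_prod_univ, Measure.prod_prod, Measure.restrict_apply_univ, measure_univ,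
      mul_one]
  simp only [lintegral_const, Measure.pi_univ, hB, Finset.prod_const, Finset.card_univ,
    Fintype.card_fin]
  have h := measure_univ (μ := poissonMeasure (lam * (volume B).toNNReal))
  rw [← Set.iUnion_of_singleton, measure_iUnion (fun a b hab => by simpa using hab)
    (fun _ => .of_discrete)] at h
  have : ∀ k : ℕ, ENNReal.ofReal (Real.exp (-(lam * (volume B).toReal))) * (lam : ℝ≥0∞) ^ k /
      k.factorial * (a * volume B ^ k) =
      a * poissonMeasure (lam * (volume B).toNNReal) {k} := by
    intro k
    rw [poissonMeasure_singleton, ENNReal.ofReal_div_of_pos (by positivity),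
      ENNReal.ofReal_mul (Real.exp_pos _).le, ENNReal.ofReal_pow (by positivity),
      ENNReal.ofReal_coe_nnreal, ENNReal.coe_mul, ENNReal.coe_toNNReal hfin, mul_pow,
      ENNReal.ofReal_natCast]
    simp only [NNReal.coe_mul, ENNReal.coe_toNNReal_eq_toReal, div_eq_mul_inv]
    ring
  simp_rw [this]
  rw [ENNReal.tsum_mul_left, h, mul_one]

theorem poissonExpect_mono {B : Set (RewardSpace d)}
    {Φ Ψ : ∀ k : ℕ, (Fin k → RewardSpace d × ℝ) → ℝ≥0∞} (hle : ∀ k y, Φ k y ≤ Ψ k y) :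
    poissonExpect lam F B Φ ≤ poissonExpect lam F B Ψ :=
  ENNReal.tsum_le_tsum fun k => mul_le_mul_right (lintegral_mono fun y => hle k y) _

theorem poissonExpect_congr_ae {B B' : Set (RewardSpace d)} (h : B =ᵐ[volume] B')
    (Φ : ∀ k : ℕ, (Fin k → RewardSpace d × ℝ) → ℝ≥0∞) :
    poissonExpect lam F B Φ = poissonExpect lam F B' Φ := by
  unfold poissonExpect
  rw [Measure.restrict_congr_set h, measure_congr h]

theorem poissonExpect_add_const [IsProbabilityMeasure F] {B : Set (RewardSpace d)}
    (hfin : volume B ≠ ∞) (Φ : ∀ k : ℕ, (Fin k → RewardSpace d × ℝ) → ℝ≥0∞) (a : ℝ≥0∞) :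
    poissonExpect lam F B (fun k y => Φ k y + a) = poissonExpect lam F B Φ + a := by
  conv_rhs => rw [← poissonExpect_const (lam := lam) (F := F) hfin a]
  unfold poissonExpect
  rw [← ENNReal.tsum_add]
  refine tsum_congr fun k => ?_
  rw [lintegral_add_right _ measurable_const, mul_add]

theorem IsPoissonRewardField.lintegral_eq_poissonExpect [IsProbabilityMeasure P] [IsProbabilityMeasure F]
    (h : IsPoissonRewardField P lam F p r) (hlam : lam ≠ 0) {B : Set (RewardSpace d)}
    (hB : MeasurableSet B) (hfin : volume B ≠ ∞)
    {Φ : ∀ k : ℕ, (Fin k → RewardSpace d × ℝ) → ℝ≥0∞}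
    (hΦ : ∀ k, Measurable (Φ k)) {Y : Ω → ℝ≥0∞}
    (hY : ∀ ω k (i : Fin k ↪ ℕ), Set.range i = {j | p j ω ∈ B} →
      Y ω = Φ k fun l => (p (i l) ω, r (i l) ω)) :
    ∫⁻ ω, Y ω ∂P = poissonExpect lam F B Φ := by
  rw [h.lintegral_eq_poissonExpect₂ hlam hB MeasurableSet.empty hfin (by simp)
    (Set.disjoint_empty B) (Φ := fun k₁ _ y => Φ k₁ fun l => y (Sum.inl l))
    (fun k₁ _ => (hΦ k₁).comp (measurable_pi_lambda _ fun l => measurable_pi_apply _))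
    (fun ω k₁ _ i hi _ => hY ω k₁ (Function.Embedding.inl.trans i) hi)]
  congr 1
  ext k y
  exact poissonExpect_const (d := d) (lam := lam) (F := F) (B := ∅) (by simp) (Φ k y)

end Expectation

/-! ### Superadditivity of the mean reward. -/

theorem ConeLE.mem_prod {d : ℕ} {z x : RewardSpace d} {L : ℝ} (h : ConeLE z x)
    (hx : x.1 ≤ z.1 + L) : x ∈ Set.Icc z.1 (z.1 + L) ×ˢ Metric.closedBall z.2 L := by
  refine ⟨⟨h.fst_le, hx⟩, ?_⟩
  rw [Metric.mem_closedBall, dist_eq_norm]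
  unfold ConeLE at h
  linarith

theorem volume_Icc_prod_closedBall_ne_top {d : ℕ} (a b R : ℝ)
    (z : EuclideanSpace ℝ (Fin (d - 1))) :
    (volume : Measure (RewardSpace d)) (Set.Icc a b ×ˢ Metric.closedBall z R) ≠ ∞ := by
  rw [Measure.volume_eq_prod, Measure.prod_prod]
  exact ENNReal.mul_ne_top (by simp) measure_closedBall_lt_top.ne

theorem measurable_chainReward_marked {d : ℕ} {ι : Type*} [Countable ι] (z : RewardSpace d)
    (L : ℝ) : Measurable fun y : ι → RewardSpace d × ℝ =>
      chainReward z L (fun l => (y l).1) (fun l => (y l).2) := by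
  have h1 : Measurable fun (y : ι → RewardSpace d × ℝ) (l : ι) => (y l).1 :=
    measurable_pi_lambda _ fun l => (measurable_pi_apply l).fst
  have h2 : Measurable fun (y : ι → RewardSpace d × ℝ) (l : ι) => (y l).2 :=
    measurable_pi_lambda _ fun l => (measurable_pi_apply l).snd
  have h := Measurable.comp (g := fun q : (ι → RewardSpace d) × (ι → ℝ) =>
    chainReward z L q.1 q.2) (measurable_chainReward z L) (h1.prodMk h2)
  simpa only [Function.comp_def] using h

section Superadditive

variable {Ω : Type*} [MeasurableSpace Ω] {P : Measure Ω} {d : ℕ}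
  {lam : ℝ≥0} {F : Measure ℝ} {p : ℕ → Ω → RewardSpace d} {r : ℕ → Ω → ℝ}

theorem IsPoissonRewardField.measurable_chainReward (h : IsPoissonRewardField P lam F p r)
    (z : RewardSpace d) (L : ℝ) : Measurable fun ω => chainReward z L (p · ω) (r · ω) := by
  have hr : Measurable fun ω i => r i ω := measurable_pi_lambda _ h.measurable
  have h := Measurable.comp (g := fun q : (ℕ → RewardSpace d) × (ℕ → ℝ) =>
    chainReward z L q.1 q.2) (_root_.measurable_chainReward z L)
    (h.locations.measurable_seq.prodMk hr)
  simpa only [Function.comp_def] using h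

theorem IsPoissonRewardField.translate (h : IsPoissonRewardField P lam F p r)
    (z : RewardSpace d) : IsPoissonRewardField P lam F (fun i ω => p i ω - z) r := by
  have := isAddHaarMeasure_volume_rewardSpace d
  have hsub : Measurable fun x : RewardSpace d => x - z := measurable_id.sub_const z
  have hcount : ∀ (q : ℕ → RewardSpace d) (A : Set (RewardSpace d)),
      pointCount (fun i => q i - z) A = pointCount q ((fun x => x - z) ⁻¹' A) := fun q A => rfl
  refine ⟨⟨fun i => hsub.comp (h.locations.measurable i), ?_, ?_, ?_⟩, h.measurable, h.nonneg,
    h.law, h.indep, ?_⟩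
  · filter_upwards [h.locations.injective] with ω hω
    exact fun i j hij => hω (sub_left_injective hij)
  · intro A hA hfin k
    have hvol : volume ((fun x : RewardSpace d => x - z) ⁻¹' A) = volume A := by
      simp_rw [sub_eq_add_neg]
      exact measure_preimage_add_right _ _ _
    simp_rw [hcount]
    rw [h.locations.poisson _ (hsub hA) (by rwa [hvol]), hvol]
  · intro n A hA hdisj
    simp_rw [hcount]
    exact h.locations.indep n _ (fun j => hsub (hA j)) fun a b hab =>
      (hdisj hab).preimage _
  · exact h.indep_locations.comp (φ := fun q : ℕ → RewardSpace d => fun i => q i - z) (ψ := id)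
      (measurable_pi_lambda _ fun i => hsub.comp (measurable_pi_apply i)) measurable_id

theorem IsPoissonRewardField.lintegral_chainReward [IsProbabilityMeasure P]
    [IsProbabilityMeasure F] (h : IsPoissonRewardField P lam F p r) (hlam : lam ≠ 0)
    (z : RewardSpace d) (L : ℝ) {B : Set (RewardSpace d)} (hB : MeasurableSet B)
    (hfin : volume B ≠ ∞) (hsub : ∀ x, ConeLE z x → x.1 ≤ z.1 + L → x ∈ B) :
    ∫⁻ ω, chainReward z L (p · ω) (r · ω) ∂P = poissonExpect lam F B fun _ y =>
      chainReward z L (fun l => (y l).1) (fun l => (y l).2) := by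
  refine h.lintegral_eq_poissonExpect hlam hB hfin
    (fun k => measurable_chainReward_marked z L) fun ω k i hi => ?_
  refine (chainReward_comp z L (p · ω) (r · ω) i.injective fun j hj hjL => ?_).symm
  rw [hi]
  exact hsub _ hj hjL

/-- The translated locations form a field with the same `lam` and `F`, and `poissonExpect` depends
on nothing else. -/
theorem IsPoissonRewardField.lintegral_chainReward_eq_zero_start [IsProbabilityMeasure P]
    [IsProbabilityMeasure F] (h : IsPoissonRewardField P lam F p r) (hlam : lam ≠ 0)
    (z : RewardSpace d) (L : ℝ) :
    ∫⁻ ω, chainReward z L (p · ω) (r · ω) ∂P = ∫⁻ ω, chainReward 0 L (p · ω) (r · ω) ∂P := by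
  have hB : MeasurableSet (Set.Icc (0 : RewardSpace d).1 ((0 : RewardSpace d).1 + L) ×ˢ
      Metric.closedBall (0 : RewardSpace d).2 L) :=
    measurableSet_Icc.prod Metric.isClosed_closedBall.measurableSet
  rw [h.lintegral_chainReward hlam 0 L hB (volume_Icc_prod_closedBall_ne_top _ _ _ _)
      fun x hx hxL => hx.mem_prod hxL,
    ← (h.translate z).lintegral_chainReward hlam 0 L hB
      (volume_Icc_prod_closedBall_ne_top _ _ _ _) fun x hx hxL => hx.mem_prod hxL]
  simp_rw [chainReward_sub]

theorem IsPoissonRewardField.superadditive [IsProbabilityMeasure P]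
    [IsProbabilityMeasure F] (h : IsPoissonRewardField P lam F p r) (hlam : lam ≠ 0)
    {L M : ℝ} (hL : 0 ≤ L) (hM : 0 ≤ M) :
    ∫⁻ ω, chainReward 0 L (p · ω) (r · ω) ∂P + ∫⁻ ω, chainReward 0 M (p · ω) (r · ω) ∂P ≤
      ∫⁻ ω, chainReward 0 (L + M) (p · ω) (r · ω) ∂P := by
  set a := ∫⁻ ω, chainReward 0 M (p · ω) (r · ω) ∂P with ha
  -- The radius `L + M` accommodates both the cone from the origin and the cone from any endpoint
  -- `z` with lateral norm at most `L`.
  let D : Set (EuclideanSpace ℝ (Fin (d - 1))) := Metric.closedBall 0 (L + M)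
  have hD : MeasurableSet D := Metric.isClosed_closedBall.measurableSet
  let B₁ : Set (RewardSpace d) := Set.Icc 0 L ×ˢ D
  let B₂ : Set (RewardSpace d) := Set.Ioc L (L + M) ×ˢ D
  let B' : Set (RewardSpace d) := Set.Icc L (L + M) ×ˢ D
  have hB₁ : MeasurableSet B₁ := measurableSet_Icc.prod hD
  have hB₂ : MeasurableSet B₂ := measurableSet_Ioc.prod hD
  have hB' : MeasurableSet B' := measurableSet_Icc.prod hD
  have hfin₁ : volume B₁ ≠ ∞ := volume_Icc_prod_closedBall_ne_top _ _ _ _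
  have hfin' : volume B' ≠ ∞ := volume_Icc_prod_closedBall_ne_top _ _ _ _
  have hfin₂ : volume B₂ ≠ ∞ := ne_top_of_le_ne_top hfin'
    (measure_mono (Set.prod_mono Set.Ioc_subset_Icc_self le_rfl))
  -- The second slab is half-open to be disjoint from the first, but the cone of `z` touches the
  -- hyperplane at `L`. That hyperplane is null, so the closed slab gives the same expectation.
  have hae : B₂ =ᵐ[volume] B' := by
    rw [Measure.volume_eq_prod]
    exact Measure.set_prod_ae_eq Ioc_ae_eq_Icc (ae_eq_refl _)
  have hdisj : Disjoint B₁ B₂ := Set.disjoint_left.2 fun x h1 h2 =>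
    absurd h1.1.2 (not_le.2 h2.1.1)
  rw [h.lintegral_eq_poissonExpect₂ hlam hB₁ hB₂ hfin₁ hfin₂ hdisj
    (Y := fun ω => chainReward 0 (L + M) (p · ω) (r · ω))
    (Φ := fun _ _ y => chainReward 0 (L + M) (fun l => (y l).1) (fun l => (y l).2))
    (fun _ _ => measurable_chainReward_marked _ _) (fun ω k₁ k₂ i h1 h2 => by
      refine (chainReward_comp 0 (L + M) (p · ω) (r · ω) i.injective fun j hj hjL => ?_).symm
      have hmem := hj.mem_prod hjL
      simp only [Prod.fst_zero, zero_add, Prod.snd_zero] at hmem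
      rcases le_or_gt (p j ω).1 L with hle | hgt
      · obtain ⟨l, hl⟩ := h1.superset (show p j ω ∈ B₁ from ⟨⟨hmem.1.1, hle⟩, hmem.2⟩)
        exact ⟨_, hl⟩
      · obtain ⟨l, hl⟩ := h2.superset (show p j ω ∈ B₂ from ⟨⟨hgt, hmem.1.2⟩, hmem.2⟩)
        exact ⟨_, hl⟩)]
  rw [h.lintegral_chainReward hlam 0 L hB₁ hfin₁ fun x hx hxL => by
      have hmem := hx.mem_prod hxL
      simp only [Prod.fst_zero, zero_add, Prod.snd_zero] at hmem
      exact ⟨hmem.1, Metric.closedBall_subset_closedBall (by linarith) hmem.2⟩,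
    ← poissonExpect_add_const hfin₁]
  refine poissonExpect_mono fun k₁ y₁ => ?_
  rw [chainReward, ENNReal.biSup_add' (p := fun S => IsAdmissible 0 L (fun l => (y₁ l).1) S)
    ⟨∅, by simp [IsAdmissible]⟩]
  refine iSup₂_le fun S hS => ?_
  -- With the first slab `y₁` and the chain `S` frozen, `z` is deterministic for the inner
  -- expectation. Taking the supremum over `S` only at the end avoids any measurable choice of an
  -- optimal chain.
  obtain ⟨z, hz1, hz2, hz⟩ := exists_chainReward_concat hL (fun l => (y₁ l).1)
    (fun l => (y₁ l).2) hS
  have hzM : poissonExpect lam F B₂ (fun _ y => chainReward z M (fun l => (y l).1)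
      (fun l => (y l).2)) = a := by
    rw [poissonExpect_congr_ae hae, ← h.lintegral_chainReward hlam z M hB' hfin' fun x hx hxM => by
      have hmem := hx.mem_prod hxM
      rw [hz1] at hmem
      refine ⟨hmem.1, ?_⟩
      have h2 := hmem.2
      rw [Metric.mem_closedBall, dist_eq_norm] at h2
      simp only [D, Metric.mem_closedBall, dist_zero_right]
      calc ‖x.2‖ = ‖z.2 + (x.2 - z.2)‖ := by congr 1; abel
        _ ≤ ‖z.2‖ + ‖x.2 - z.2‖ := norm_add_le _ _
        _ ≤ L + M := add_le_add hz2 h2, h.lintegral_chainReward_eq_zero_start hlam]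
  rw [← hzM, add_comm, ← poissonExpect_add_const hfin₂]
  refine poissonExpect_mono fun k₂ y₂ => ?_
  rw [add_comm]
  refine (hz M hM (fun l => (y₂ l).1) (fun l => (y₂ l).2)).trans (le_of_eq ?_)
  congr 1 <;> (funext l; rcases l with l | l <;> rfl)

end Superadditive

/-! ### Exponential moments of exceedance counts. -/

theorem lintegral_pi_fin_prod {α : Type*} [MeasurableSpace α] (m : Measure α) [SigmaFinite m]
    {g : α → ℝ≥0∞} (hg : Measurable g) (k : ℕ) :
    ∫⁻ y, ∏ l, g (y l) ∂(Measure.pi fun _ : Fin k => m) = (∫⁻ x, g x ∂m) ^ k := by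
  induction k with
  | zero => simp
  | succ k ih =>
    have hprod : ∀ k, Measurable fun y : Fin k → α => ∏ l, g (y l) := fun k =>
      Finset.measurable_prod _ fun l _ => hg.comp (measurable_pi_apply l)
    rw [← (measurePreserving_piFinSuccAbove (fun _ : Fin (k + 1) => m) 0).symm.lintegral_comp
      (hprod _)]
    have : ∀ y : α × (Fin k → α), ∏ l : Fin (k + 1),
        g ((MeasurableEquiv.piFinSuccAbove (fun _ : Fin (k + 1) => α) 0).symm y l) =
        g y.1 * ∏ l, g (y.2 l) := by
      intro y
      rw [Fin.prod_univ_succ]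
      rfl
    simp_rw [this]
    rw [lintegral_prod_mul hg.aemeasurable (hprod k).aemeasurable, ih, pow_succ, mul_comm]

/-- The number of targets in `A` whose reward exceeds `s`. -/
noncomputable def exceedanceCount {d : ℕ} {ι : Type*} (A : Set (RewardSpace d)) (s : ℝ)
    (x : ι → RewardSpace d) (ρ : ι → ℝ) : ℝ≥0∞ :=
  ∑' i, {i | x i ∈ A ∧ s < ρ i}.indicator 1 i

theorem measurable_exceedanceCount {d : ℕ} {A : Set (RewardSpace d)} (hA : MeasurableSet A)
    (s : ℝ) : Measurable fun q : (ℕ → RewardSpace d) × (ℕ → ℝ) =>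
      exceedanceCount A s q.1 q.2 := by
  unfold exceedanceCount
  refine Measurable.tsum fun i => ?_
  have hm : MeasurableSet {q : (ℕ → RewardSpace d) × (ℕ → ℝ) | q.1 i ∈ A ∧ s < q.2 i} :=
    (((measurable_pi_apply i).comp measurable_fst) hA).inter
      (((measurable_pi_apply i).comp measurable_snd) measurableSet_Ioi)
  exact (measurable_one (α := ℝ≥0∞)).indicator hm

theorem exceedanceCount_eq_sum {d k : ℕ} {A : Set (RewardSpace d)} {s : ℝ}
    {x : ℕ → RewardSpace d} {ρ : ℕ → ℝ} (i : Fin k ↪ ℕ)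
    (hi : Set.range i = {j | x j ∈ A}) :
    exceedanceCount A s x ρ = ∑ l, if s < ρ (i l) then 1 else 0 := by
  classical
  unfold exceedanceCount
  have : ∀ j, {i | x i ∈ A ∧ s < ρ i}.indicator (1 : ℕ → ℝ≥0∞) j =
      (Set.range i).indicator (fun j => if s < ρ j then (1 : ℝ≥0∞) else 0) j := by
    intro j
    rw [hi]
    simp only [Set.indicator, Set.mem_ofPred_eq, Pi.one_apply]
    by_cases h1 : x j ∈ A <;> by_cases h2 : s < ρ j <;> simp [h1, h2]
  simp_rw [this]
  rw [← tsum_subtype, tsum_range (fun j => if s < ρ j then (1 : ℝ≥0∞) else 0) i.injective,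
    tsum_fintype]

section ExpMoment

variable {Ω : Type*} [MeasurableSpace Ω] {P : Measure Ω} [IsProbabilityMeasure P] {d : ℕ}
  {lam : ℝ≥0} {F : Measure ℝ} {p : ℕ → Ω → RewardSpace d}
  {r : ℕ → Ω → ℝ}

/-- By thinning, the count is Poisson with mean λ |A| F(s, ∞), and a Poisson variable of mean m
satisfies E exp(K) = exp(m (e - 1)). Here this is computed directly: the exponential of the count is
a product of one factor, e or 1, per target. -/
theorem IsPoissonRewardField.lintegral_exp_exceedanceCount [IsProbabilityMeasure F]
    (h : IsPoissonRewardField P lam F p r) (hlam : lam ≠ 0) {A : Set (RewardSpace d)}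
    (hA : MeasurableSet A) (hfin : volume A ≠ ∞) (s : ℝ) :
    ∫⁻ ω, ENNReal.ofReal (Real.exp (exceedanceCount A s (p · ω) (r · ω)).toReal) ∂P =
      ENNReal.ofReal (Real.exp
        (lam * (volume A).toReal * (F.real (Set.Ioi s) * (Real.exp 1 - 1)))) := by
  classical
  let g : RewardSpace d × ℝ → ℝ≥0∞ := fun y =>
    if s < y.2 then ENNReal.ofReal (Real.exp 1) else 1
  have hg : Measurable g := Measurable.ite (measurable_snd measurableSet_Ioi) measurable_const
    measurable_const
  rw [h.lintegral_eq_poissonExpect hlam hA hfin (Φ := fun k y => ∏ l, g (y l))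
    (fun k => Finset.measurable_prod _ fun l _ => hg.comp (measurable_pi_apply l))
    fun ω k i hi => ?_]
  swap
  · rw [exceedanceCount_eq_sum i hi, ENNReal.toReal_sum (fun l _ => by split_ifs <;> simp),
      Real.exp_sum, ENNReal.ofReal_prod_of_nonneg fun _ _ => (Real.exp_pos _).le]
    refine Finset.prod_congr rfl fun l _ => ?_
    simp only [g]
    split_ifs <;> simp
  unfold poissonExpect
  have hq := measureReal_nonneg (μ := F) (s := Set.Ioi s)
  have he : 0 ≤ Real.exp 1 - 1 := by linarith [Real.add_one_le_exp (1 : ℝ)]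
  set G : ℝ := 1 + F.real (Set.Ioi s) * (Real.exp 1 - 1) with hG
  have hG0 : 0 ≤ G := by positivity
  have hgint : ∫⁻ y, g y ∂((volume.restrict A).prod F) =
      ENNReal.ofReal ((volume A).toReal * G) := by
    have hsplit : ∀ y : RewardSpace d × ℝ, g y =
        1 + (Set.univ ×ˢ Set.Ioi s : Set (RewardSpace d × ℝ)).indicator
          (fun _ => ENNReal.ofReal (Real.exp 1 - 1)) y := by
      intro y
      simp only [g, Set.indicator, Set.mem_prod, Set.mem_univ, true_and, Set.mem_Ioi]
      split_ifs
      · rw [← ENNReal.ofReal_one, ← ENNReal.ofReal_add zero_le_one he]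
        congr 1
        ring
      · simp
    simp_rw [hsplit]
    rw [lintegral_add_left measurable_const, lintegral_indicator
      (MeasurableSet.univ.prod measurableSet_Ioi), setLIntegral_const, lintegral_const, one_mul,
      ← Set.univ_prod_univ, Measure.prod_prod, Measure.prod_prod, Measure.restrict_apply_univ,
      measure_univ, mul_one, ← ofReal_measureReal (μ := F) (s := Set.Ioi s),
      ← ENNReal.ofReal_toReal hfin, ← ENNReal.ofReal_mul (by positivity),
      ← ENNReal.ofReal_mul he, ← ENNReal.ofReal_add (by positivity) (by positivity),
      ENNReal.toReal_ofReal (by positivity)]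
    congr 1
    rw [hG]
    ring
  simp_rw [lintegral_pi_fin_prod _ hg, hgint]
  have hterm : ∀ k : ℕ, ENNReal.ofReal (Real.exp (-(lam * (volume A).toReal))) *
      (lam : ℝ≥0∞) ^ k / k.factorial * ENNReal.ofReal ((volume A).toReal * G) ^ k =
      ENNReal.ofReal (Real.exp (-(lam * (volume A).toReal))) *
        ENNReal.ofReal ((lam * ((volume A).toReal * G)) ^ k / k.factorial) := by
    intro k
    rw [ENNReal.ofReal_div_of_pos (by positivity), mul_pow,
      ENNReal.ofReal_mul (p := (lam : ℝ) ^ k) (by positivity), ENNReal.ofReal_pow (by positivity), ENNReal.ofReal_pow (by positivity),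
      ENNReal.ofReal_coe_nnreal, ENNReal.ofReal_natCast]
    simp only [div_eq_mul_inv]
    ring
  have hsum := NormedSpace.expSeries_div_hasSum_exp ((lam : ℝ) * ((volume A).toReal * G))
  simp_rw [hterm]
  rw [ENNReal.tsum_mul_left, ← ENNReal.ofReal_tsum_of_nonneg (fun k => by positivity)
    hsum.summable, hsum.tsum_eq, ← Real.exp_eq_exp_ℝ, ← ENNReal.ofReal_mul (Real.exp_pos _).le,
    ← Real.exp_add]
  congr 2
  rw [hG]
  ring

theorem IsPoissonRewardField.ae_exceedanceCount_ne_top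
    (h : IsPoissonRewardField P lam F p r) {A : Set (RewardSpace d)}
    (hA : MeasurableSet A) (hfin : volume A ≠ ∞) (s : ℝ) :
    ∀ᵐ ω ∂P, exceedanceCount A s (p · ω) (r · ω) ≠ ∞ := by
  filter_upwards [h.locations.ae_finite hA hfin] with ω ⟨k, hk⟩
  have hcard := card_embedding_range_eq k hk
  have hne : ENat.card {i : Fin k ↪ ℕ // Set.range i = {j | p j ω ∈ A}} ≠ 0 := by
    rw [hcard]
    exact_mod_cast k.factorial_ne_zero
  rw [Ne, ENat.card_eq_zero_iff_empty, not_isEmpty_iff] at hne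
  rw [exceedanceCount_eq_sum hne.some.1 hne.some.2]
  exact ENNReal.sum_ne_top.2 fun l _ => by split_ifs <;> simp

end ExpMoment

/-- This is 1 + u ≤ exp u at u = K - log c. It linearises the maximum of many counts: with `c` at
least the sum of their exponential moments, the last term has mean at most 1, which the 1 on the
left cancels. -/
theorem one_add_le_log_add_exp_div {K : ℝ≥0∞} (hK : K ≠ ∞) {c : ℝ} (hc : 1 ≤ c) :
    K + 1 ≤ ENNReal.ofReal (Real.log c) +
      ENNReal.ofReal (Real.exp K.toReal) / ENNReal.ofReal c := by
  have hc0 : 0 < c := by linarith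
  rw [← ENNReal.ofReal_div_of_pos hc0, ← ENNReal.ofReal_add (Real.log_nonneg hc) (by positivity),
    ← ENNReal.ofReal_toReal hK, ← ENNReal.ofReal_one,
    ← ENNReal.ofReal_add ENNReal.toReal_nonneg zero_le_one,
    ENNReal.toReal_ofReal ENNReal.toReal_nonneg]
  apply ENNReal.ofReal_le_ofReal
  have h := Real.add_one_le_exp (K.toReal - Real.log c)
  rw [Real.exp_sub, Real.exp_log hc0] at h
  linarith

/-! ### Covering all paths by lattice tubes. -/

/-- The cell reached after `k` steps by the lattice walk with increments `γ j c - 1`. -/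
def walkPosition {m e : ℕ} (γ : Fin m → Fin e → Fin 3) (k : ℕ) (c : Fin e) : ℤ :=
  ∑ j ∈ Finset.range k, if h : j < m then ((γ ⟨j, h⟩ c : ℕ) : ℤ) - 1 else 0

theorem exists_walkPosition_eq {m e : ℕ} (f : ℕ → Fin e → ℤ) (h0 : ∀ c, f 0 c = 0)
    (hstep : ∀ j c, j < m → |f (j + 1) c - f j c| ≤ 1) :
    ∃ γ : Fin m → Fin e → Fin 3, ∀ k ≤ m, ∀ c, walkPosition γ k c = f k c := by
  refine ⟨fun j c => ⟨(f (j + 1) c - f j c + 1).toNat, by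
    have := abs_le.1 (hstep j c j.2)
    omega⟩, fun k hk c => ?_⟩
  unfold walkPosition
  have : ∀ j ∈ Finset.range k, (if h : j < m then
      (((f (j + 1) c - f j c + 1).toNat : ℕ) : ℤ) - 1 else 0) = f (j + 1) c - f j c := by
    intro j hj
    have hjm : j < m := (Finset.mem_range.1 hj).trans_le hk
    have := abs_le.1 (hstep j c hjm)
    rw [dif_pos hjm]
    omega
  rw [Finset.sum_congr rfl this, Finset.sum_range_sub (fun j => f j c), h0, sub_zero]

theorem abs_floor_sub_floor_le_one {x y : ℝ} (h : |x - y| ≤ 1) : |⌊x⌋ - ⌊y⌋| ≤ 1 := by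
  rw [abs_le] at h ⊢
  have h1 := Int.floor_le x
  have h2 := Int.lt_floor_add_one x
  have h3 := Int.floor_le y
  have h4 := Int.lt_floor_add_one y
  constructor
  · have : (⌊y⌋ : ℝ) < ⌊x⌋ + 2 := by linarith
    have : ⌊y⌋ < ⌊x⌋ + 2 := by exact_mod_cast this
    omega
  · have : (⌊x⌋ : ℝ) < ⌊y⌋ + 2 := by linarith
    have : ⌊x⌋ < ⌊y⌋ + 2 := by exact_mod_cast this
    omega

theorem EuclideanSpace.norm_le_sum_abs {e : ℕ} (y : EuclideanSpace ℝ (Fin e)) :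
    ‖y‖ ≤ ∑ c, |y c| := by
  conv_lhs => rw [← (EuclideanSpace.basisFun (Fin e) ℝ).sum_repr y]
  refine (norm_sum_le _ _).trans (Finset.sum_le_sum fun c _ => ?_)
  rw [norm_smul]
  simp

/-- The union of the cylinders around the cells visited by a lattice walk of mesh `a`. -/
def walkTube (d n : ℕ) (a : ℝ) (γ : Fin (n - 1) → Fin (d - 1) → Fin 3) :
    Set (RewardSpace d) :=
  ⋃ k : Fin n, Set.Icc (k * a) ((k + 1) * a) ×ˢ
    Metric.closedBall (WithLp.toLp 2 fun c => a * walkPosition γ k c) (a * d)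

theorem measurableSet_walkTube (d n : ℕ) (a : ℝ) (γ : Fin (n - 1) → Fin (d - 1) → Fin 3) :
    MeasurableSet (walkTube d n a γ) :=
  MeasurableSet.iUnion fun _ => measurableSet_Icc.prod Metric.isClosed_closedBall.measurableSet

theorem volume_walkTube_le {d : ℕ} (n : ℕ) {a : ℝ} (ha : 0 ≤ a)
    (γ : Fin (n - 1) → Fin (d - 1) → Fin 3) :
    volume (walkTube d n a γ) ≤ ENNReal.ofReal (n * (a * ((a * d) ^ (d - 1) *
      (volume (Metric.closedBall (0 : EuclideanSpace ℝ (Fin (d - 1))) 1)).toReal))) := by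
  refine (measure_iUnion_le _).trans ?_
  rw [tsum_fintype]
  refine (Finset.sum_le_card_nsmul Finset.univ _ (ENNReal.ofReal (a * ((a * d) ^ (d - 1) *
    (volume (Metric.closedBall (0 : EuclideanSpace ℝ (Fin (d - 1))) 1)).toReal)))
    fun k _ => le_of_eq ?_).trans ?_
  · rw [Measure.volume_eq_prod, Measure.prod_prod, Real.volume_Icc,
      Measure.addHaar_closedBall' _ _ (by positivity), finrank_euclideanSpace, Fintype.card_fin,
      ENNReal.ofReal_mul ha, ENNReal.ofReal_mul (by positivity),
      ENNReal.ofReal_toReal measure_closedBall_lt_top.ne]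
    congr 2
    ring
  · rw [Finset.card_univ, Fintype.card_fin, nsmul_eq_mul,
      ENNReal.ofReal_mul (p := (n : ℝ)) (by positivity),
      ENNReal.ofReal_natCast]

/-- Round the lateral position at the times `k * a` down to the mesh. Each coordinate moves by at
most one mesh between these times, so its floor changes by -1, 0 or 1. The radius `a * d` is the
rounding error, at most `a` in each of the `d - 1` coordinates, plus the drift of at most `a` before
the next mesh time. -/
theorem exists_walkTube {d : ℕ} (hd : 1 ≤ d) {L : ℝ} {n : ℕ} (hn : 0 < n) (hL : 0 < L)
    {x : ℝ → RewardSpace d} (hx : x ∈ feasiblePaths d 1 L) :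
    ∃ γ, ∀ t ∈ Set.Icc 0 L, x t ∈ walkTube d n (L / n) γ := by
  set a := L / n with ha_def
  have hn' : (0 : ℝ) < n := by exact_mod_cast hn
  have ha : 0 < a := by positivity
  have hna : n * a = L := by rw [ha_def]; field_simp
  have hcone : ∀ s t, 0 ≤ s → s ≤ t → t ≤ L → ‖(x t).2 - (x s).2‖ ≤ t - s := by
    intro s t hs hst ht
    have h := feasiblePaths_coneLE hx hs hst (by simpa using ht)
    obtain ⟨u, -, -, hu⟩ := hx
    unfold ConeLE at h
    rw [hu s ⟨hs, by simpa using hst.trans ht⟩, hu t ⟨hs.trans hst, by simpa using ht⟩] at h ⊢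
    simpa using h
  have hx1 : ∀ t ∈ Set.Icc 0 L, (x t).1 = t := by
    intro t ht
    obtain ⟨u, -, -, hu⟩ := hx
    rw [hu t (by simpa using ht)]
    simp
  have hx0 : (x 0).2 = 0 := by
    obtain ⟨u, -, -, hu⟩ := hx
    rw [hu 0 ⟨le_rfl, by simpa using hL.le⟩]
    simp
  have hka : ∀ k : ℕ, k ≤ n → k * a ≤ L := by
    intro k hk
    rw [← hna]
    gcongr
  obtain ⟨γ, hγ⟩ := exists_walkPosition_eq (m := n - 1)
    (fun (k : ℕ) (c : Fin (d - 1)) => ⌊(x (k * a)).2 c / a⌋) (fun c => by simp [hx0]) (by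
      intro j c hj
      apply abs_floor_sub_floor_le_one
      rw [← sub_div, abs_div, abs_of_pos ha, div_le_one ha]
      have h1 := hcone (j * a) ((j + 1 : ℕ) * a) (by positivity) (by gcongr; simp)
        (hka _ (by omega))
      have h2 := PiLp.norm_apply_le ((x ((j + 1 : ℕ) * a)).2 - (x (j * a)).2) c
      rw [PiLp.sub_apply, Real.norm_eq_abs] at h2
      refine h2.trans (h1.trans (le_of_eq ?_))
      push_cast
      ring)
  refine ⟨γ, fun t ht => ?_⟩
  obtain ⟨k, hkn, hk1, hk2⟩ : ∃ k : ℕ, k < n ∧ k * a ≤ t ∧ t ≤ (k + 1) * a := by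
    rcases ht.2.lt_or_eq with hlt | heq
    · refine ⟨⌊t / a⌋₊, ?_, ?_, ?_⟩
      · rw [Nat.floor_lt (div_nonneg ht.1 ha.le), div_lt_iff₀ ha, hna]
        exact hlt
      · rw [← le_div_iff₀ ha]
        exact Nat.floor_le (div_nonneg ht.1 ha.le)
      · rw [← div_le_iff₀ ha]
        exact (Nat.lt_floor_add_one _).le
    -- At the final time the floor would give the cell `n`, which does not exist; the last closed
    -- cell contains that time.
    · refine ⟨n - 1, by omega, ?_, ?_⟩
      · rw [heq]
        exact hka _ (by omega)
      · rw [heq, ← hna, Nat.cast_sub hn]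
        simp
  refine Set.mem_iUnion.2 ⟨⟨k, hkn⟩, ⟨?_, ?_⟩⟩
  · rw [hx1 t ht]
    exact ⟨hk1, hk2⟩
  · rw [Metric.mem_closedBall, dist_eq_norm]
    have h1 := hcone (k * a) t (by positivity) hk1 ht.2
    set w : EuclideanSpace ℝ (Fin (d - 1)) :=
      WithLp.toLp 2 fun c => a * (walkPosition γ k c : ℝ) with hw
    have h2 : ‖(x (k * a)).2 - w‖ ≤ (d - 1) * a := by
      refine (EuclideanSpace.norm_le_sum_abs _).trans ?_
      refine (Finset.sum_le_card_nsmul Finset.univ _ a fun c _ => ?_).trans ?_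
      · rw [PiLp.sub_apply, hw]
        dsimp only
        rw [hγ k (by omega) c]
        have h3 := Int.floor_le ((x (k * a)).2 c / a)
        have h4 := Int.lt_floor_add_one ((x (k * a)).2 c / a)
        rw [le_div_iff₀ ha] at h3
        rw [div_lt_iff₀ ha] at h4
        rw [abs_le]
        constructor <;> nlinarith
      · rw [Finset.card_univ, Fintype.card_fin, nsmul_eq_mul, Nat.cast_sub hd, Nat.cast_one]
    calc ‖(x t).2 - w‖ = ‖((x t).2 - (x (k * a)).2) + ((x (k * a)).2 - w)‖ := by congr 1; abel
      _ ≤ ‖(x t).2 - (x (k * a)).2‖ + ‖(x (k * a)).2 - w‖ := norm_add_le _ _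
      _ ≤ (t - k * a) + (d - 1) * a := add_le_add h1 h2
      _ ≤ a * d := by linarith

/-! ### The linear upper bound on the mean reward. -/

section UpperBound

variable {Ω : Type*} [MeasurableSpace Ω] {P : Measure Ω} [IsProbabilityMeasure P] {d : ℕ}
  {lam : ℝ≥0} {F : Measure ℝ} [IsProbabilityMeasure F] {p : ℕ → Ω → RewardSpace d}
  {r : ℕ → Ω → ℝ}

/-- The rewards replaced by the indicator that they exceed `s`. -/
noncomputable def exceedanceIndicator {ι : Type*} (s : ℝ) (ρ : ι → ℝ) : ι → ℝ :=
  fun i => (Set.Ioi s).indicator 1 (ρ i)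

theorem chainReward_exceedanceIndicator_le {d : ℕ} (hd : 1 ≤ d) {L : ℝ} (hL : 0 < L) {n : ℕ}
    (hn : 0 < n) (s : ℝ) (x : ℕ → RewardSpace d) (ρ : ℕ → ℝ) :
    chainReward 0 L x (exceedanceIndicator s ρ) ≤
      ⨆ γ, exceedanceCount (walkTube d n (L / n) γ) s x ρ := by
  classical
  -- The chain reward does not involve the speed, so paths of speed 1 may be used, for which time is
  -- the longitudinal coordinate.
  rw [← optimalReward_eq_chainReward one_pos hL]
  refine iSup₂_le fun π hπ => ?_
  obtain ⟨γ, hγ⟩ := exists_walkTube hd hn hL hπ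
  refine le_iSup_of_le γ (ENNReal.tsum_le_tsum fun i => ?_)
  split_ifs with h
  · obtain ⟨t, ht, hti⟩ := h
    rw [div_one] at ht
    have hmem : x i ∈ walkTube d n (L / n) γ := hti ▸ hγ t ht
    by_cases hs : s < ρ i <;> simp [exceedanceIndicator, Set.indicator, hs, hmem]
  · exact zero_le

theorem IsPoissonRewardField.lintegral_exceedance_le (h : IsPoissonRewardField P lam F p r)
    (hlam : lam ≠ 0) (hd : 1 ≤ d) {L : ℝ} (hL : 0 < L) {n : ℕ} (hn : 0 < n) (s : ℝ) :
    ∫⁻ ω, chainReward 0 L (p · ω) (exceedanceIndicator s (r · ω)) ∂P ≤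
      ENNReal.ofReal (((n - 1 : ℕ) : ℝ) * ((d - 1 : ℕ) : ℝ) * Real.log 3 +
        lam * (n * (L / n * ((L / n * d) ^ (d - 1) *
          (volume (Metric.closedBall (0 : EuclideanSpace ℝ (Fin (d - 1))) 1)).toReal))) *
        (F.real (Set.Ioi s) * (Real.exp 1 - 1))) := by
  classical
  have hq := measureReal_nonneg (μ := F) (s := Set.Ioi s)
  have he : 0 ≤ Real.exp 1 - 1 := by linarith [Real.add_one_le_exp (1 : ℝ)]
  set a := L / n with ha_def
  have ha : 0 ≤ a := by positivity
  set V : ℝ := n * (a * ((a * d) ^ (d - 1) *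
    (volume (Metric.closedBall (0 : EuclideanSpace ℝ (Fin (d - 1))) 1)).toReal)) with hV
  have hV0 : 0 ≤ V := by positivity
  set b : ℝ := lam * V * (F.real (Set.Ioi s) * (Real.exp 1 - 1)) with hb
  have hb0 : 0 ≤ b := by positivity
  -- The number of walks times a common bound for their exponential moments. Its logarithm is the
  -- entropy of the walks plus the volume term.
  set c : ℝ := (3 ^ (d - 1)) ^ (n - 1) * Real.exp b with hc
  have hc1 : 1 ≤ c := by
    have h1 : (1 : ℝ) ≤ (3 ^ (d - 1)) ^ (n - 1) := one_le_pow₀ (one_le_pow₀ (by norm_num))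
    have h2 : 1 ≤ Real.exp b := Real.one_le_exp hb0
    nlinarith
  have hlogc : Real.log c = ((n - 1 : ℕ) : ℝ) * ((d - 1 : ℕ) : ℝ) * Real.log 3 + b := by
    rw [hc, Real.log_mul (by positivity) (by positivity), Real.log_exp, Real.log_pow,
      Real.log_pow]
    ring
  rw [← hlogc]
  let A := walkTube d n a
  have hAm : ∀ γ, MeasurableSet (A γ) := fun γ => measurableSet_walkTube d n a γ
  have hAle : ∀ γ, volume (A γ) ≤ ENNReal.ofReal V := fun γ => volume_walkTube_le n ha γ
  have hAfin : ∀ γ, volume (A γ) ≠ ∞ := fun γ => ne_top_of_le_ne_top (by simp) (hAle γ)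
  let K : (Fin (n - 1) → Fin (d - 1) → Fin 3) → Ω → ℝ≥0∞ := fun γ ω =>
    exceedanceCount (A γ) s (p · ω) (r · ω)
  have hr : Measurable fun ω i => r i ω := measurable_pi_lambda _ h.measurable
  have hK : ∀ γ, Measurable (K γ) := fun γ => by
    have := Measurable.comp (g := fun q : (ℕ → RewardSpace d) × (ℕ → ℝ) =>
      exceedanceCount (A γ) s q.1 q.2) (measurable_exceedanceCount (hAm γ) s)
      (h.locations.measurable_seq.prodMk hr)
    simpa only [Function.comp_def] using this
  have hKexp : ∀ γ, Measurable fun ω => ENNReal.ofReal (Real.exp (K γ ω).toReal) := fun γ =>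
    (Real.measurable_exp.comp (hK γ).ennreal_toReal).ennreal_ofReal
  have hpoint : ∀ᵐ ω ∂P, chainReward 0 L (p · ω) (exceedanceIndicator s (r · ω)) + 1 ≤
      ENNReal.ofReal (Real.log c) +
        (∑ γ, ENNReal.ofReal (Real.exp (K γ ω).toReal)) / ENNReal.ofReal c := by
    have hall : ∀ᵐ ω ∂P, ∀ γ, K γ ω ≠ ∞ :=
      ae_all_iff.2 fun γ => h.ae_exceedanceCount_ne_top (hAm γ) (hAfin γ) s
    filter_upwards [hall] with ω hω
    refine (add_le_add_left (chainReward_exceedanceIndicator_le hd hL hn s _ _) 1).trans ?_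
    rw [ENNReal.iSup_add]
    refine iSup_le fun γ => (one_add_le_log_add_exp_div (hω γ) hc1).trans ?_
    gcongr
    exact Finset.single_le_sum (f := fun γ => ENNReal.ofReal (Real.exp (K γ ω).toReal))
      (fun _ _ => zero_le) (Finset.mem_univ γ)
  have hint : ∫⁻ ω, (∑ γ, ENNReal.ofReal (Real.exp (K γ ω).toReal)) / ENNReal.ofReal c ∂P ≤
      1 := by
    simp_rw [div_eq_mul_inv]
    rw [lintegral_mul_const _ (Finset.measurable_sum _ fun γ _ => hKexp γ),
      lintegral_finsetSum _ fun γ _ => hKexp γ, ← div_eq_mul_inv]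
    refine ENNReal.div_le_of_le_mul ?_
    rw [one_mul]
    refine (Finset.sum_le_card_nsmul Finset.univ _ (ENNReal.ofReal (Real.exp b))
      fun γ _ => ?_).trans (le_of_eq ?_)
    · rw [h.lintegral_exp_exceedanceCount hlam (hAm γ) (hAfin γ) s]
      refine ENNReal.ofReal_le_ofReal (Real.exp_le_exp.2 ?_)
      rw [hb]
      have : (volume (A γ)).toReal ≤ V := ENNReal.toReal_le_of_le_ofReal hV0 (hAle γ)
      gcongr
    · rw [nsmul_eq_mul, hc, ENNReal.ofReal_mul (by positivity)]
      congr 1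
      rw [← ENNReal.ofReal_natCast]
      congr 1
      simp
  have hfinal := lintegral_mono_ae hpoint
  rw [lintegral_add_right _ measurable_const, lintegral_const, measure_univ, one_mul,
    lintegral_add_left measurable_const, lintegral_const, measure_univ, mul_one] at hfinal
  exact (ENNReal.add_le_add_iff_right ENNReal.one_ne_top).1
    (hfinal.trans (add_le_add_right hint _))

/-- With y = L (λ q)^(1/d), the preceding bound is a multiple of (n - 1) plus a multiple of n
(y/n)^d. Choosing n of order y balances the two and produces the power 1/d. -/
theorem IsPoissonRewardField.exists_lintegral_exceedance_le
    (h : IsPoissonRewardField P lam F p r) (hlam : lam ≠ 0) (hd : 1 ≤ d) :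
    ∃ C : ℝ, 0 ≤ C ∧ ∀ L, 0 < L → ∀ s,
      ∫⁻ ω, chainReward 0 L (p · ω) (exceedanceIndicator s (r · ω)) ∂P ≤
        ENNReal.ofReal (C * L * F.real (Set.Ioi s) ^ (1 / (d : ℝ))) := by
  have he : 0 ≤ Real.exp 1 - 1 := by linarith [Real.add_one_le_exp (1 : ℝ)]
  set β : ℝ := (volume (Metric.closedBall (0 : EuclideanSpace ℝ (Fin (d - 1))) 1)).toReal
  have hβ : 0 ≤ β := ENNReal.toReal_nonneg
  have hlog : 0 ≤ Real.log 3 := Real.log_nonneg (by norm_num)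
  set C₀ : ℝ := ((d - 1 : ℕ) : ℝ) * Real.log 3 + (d : ℝ) ^ (d - 1) * β * (Real.exp 1 - 1)
    with hC₀
  have hC₀0 : 0 ≤ C₀ := by positivity
  refine ⟨C₀ * (lam : ℝ) ^ (1 / (d : ℝ)), by positivity, fun L hL s => ?_⟩
  set q := F.real (Set.Ioi s) with hq_def
  have hq : 0 ≤ q := measureReal_nonneg
  set y : ℝ := L * ((lam : ℝ) * q) ^ (1 / (d : ℝ)) with hy
  have hy0 : 0 ≤ y := by positivity
  have hyd : y ^ d = L ^ d * (lam * q) := by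
    rw [hy, mul_pow, ← Real.rpow_natCast (((lam : ℝ) * q) ^ (1 / (d : ℝ))), ← Real.rpow_mul
      (by positivity), one_div, inv_mul_cancel₀ (by positivity), Real.rpow_one]
  -- This gives both n - 1 ≤ y ≤ n. Only n - 1 steps are free, and this matters for small y: an
  -- entropy term of order n would not vanish with `q` and could not be integrated over all levels.
  set n := ⌊y⌋₊ + 1 with hn
  have hn0 : (0 : ℝ) < n := by positivity
  have hyn : y ≤ n := by
    rw [hn]; push_cast
    exact (Nat.lt_floor_add_one y).le
  refine (h.lintegral_exceedance_le hlam hd hL (n := n) (by omega) s).trans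
    (ENNReal.ofReal_le_ofReal ?_)
  have h1 : ((n - 1 : ℕ) : ℝ) ≤ y := by
    rw [hn, Nat.add_sub_cancel]
    exact Nat.floor_le hy0
  have h2 : n * (y / n) ^ d ≤ y := by
    have : (y / n) ^ d ≤ y / n :=
      pow_le_of_le_one (by positivity) ((div_le_one hn0).2 hyn) (by omega)
    calc n * (y / n) ^ d ≤ n * (y / n) := by gcongr
      _ = y := by field_simp
  have h3 : lam * (n * (L / n * ((L / n * d) ^ (d - 1) * β))) * (q * (Real.exp 1 - 1)) =
      (d : ℝ) ^ (d - 1) * β * (Real.exp 1 - 1) * (n * (y / n) ^ d) := by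
    have hpow : (L / n) ^ d = L / n * (L / n) ^ (d - 1) := by
      rw [← pow_succ']
      congr 1
      omega
    have : (y / n) ^ d = (L / n) ^ d * (lam * q) := by
      rw [div_pow, hyd, div_pow]
      ring
    rw [this, hpow, mul_pow]
    ring
  rw [h3]
  calc ((n - 1 : ℕ) : ℝ) * ((d - 1 : ℕ) : ℝ) * Real.log 3 +
        (d : ℝ) ^ (d - 1) * β * (Real.exp 1 - 1) * (n * (y / n) ^ d)
      ≤ y * ((d - 1 : ℕ) : ℝ) * Real.log 3 + (d : ℝ) ^ (d - 1) * β * (Real.exp 1 - 1) * y := by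
        gcongr
    _ = C₀ * (lam : ℝ) ^ (1 / (d : ℝ)) * L * q ^ (1 / (d : ℝ)) := by
        rw [hC₀, hy, Real.mul_rpow (by positivity) hq]
        ring

theorem ofReal_eq_lintegral_exceedance (x : ℝ) : ENNReal.ofReal x =
    ∫⁻ s in Set.Ioi 0, ENNReal.ofReal ((Set.Ioi s).indicator 1 x) := by
  have : ∀ s, ENNReal.ofReal ((Set.Ioi s).indicator (1 : ℝ → ℝ) x) =
      (Set.Iio x).indicator 1 s := by
    intro s
    by_cases hs : s < x <;> simp [Set.indicator, hs]
  simp_rw [this]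
  rw [lintegral_indicator_one measurableSet_Iio, Measure.restrict_apply measurableSet_Iio,
    Set.inter_comm, Set.Ioi_inter_Iio, Real.volume_Ioo, sub_zero]

theorem measurable_exceedanceIndicator :
    Measurable fun q : ℝ × (ℕ → ℝ) => exceedanceIndicator q.1 q.2 := by
  refine measurable_pi_lambda _ fun i => ?_
  have : (fun q : ℝ × (ℕ → ℝ) => exceedanceIndicator q.1 q.2 i) =
      {q : ℝ × (ℕ → ℝ) | q.1 < q.2 i}.indicator 1 := by
    ext q
    simp [exceedanceIndicator, Set.indicator]
  rw [this]
  exact (measurable_one (α := ℝ)).indicator (measurableSet_lt measurable_fst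
    ((measurable_pi_apply i).comp measurable_snd))

/-- Layer-cake formula along a single chain, which is then replaced at each level by the best chain
for that level. -/
theorem chainReward_le_lintegral_exceedance {d : ℕ} (L : ℝ) (x : ℕ → RewardSpace d)
    (ρ : ℕ → ℝ) : chainReward 0 L x ρ ≤
      ∫⁻ s in Set.Ioi 0, chainReward 0 L x (exceedanceIndicator s ρ) := by
  refine iSup₂_le fun S hS => ?_
  rw [Finset.sum_congr rfl fun i _ => ofReal_eq_lintegral_exceedance (ρ i)]
  rw [← lintegral_finsetSum]
  · exact lintegral_mono fun s => le_chainReward hS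
  · intro i _
    have : (fun s => ENNReal.ofReal ((Set.Ioi s).indicator (1 : ℝ → ℝ) (ρ i))) =
        (Set.Iio (ρ i)).indicator 1 := by
      ext s
      by_cases hs : s < ρ i <;> simp [Set.indicator, hs]
    rw [this]
    exact measurable_one.indicator measurableSet_Iio

theorem IsPoissonRewardField.exists_lintegral_chainReward_le
    (h : IsPoissonRewardField P lam F p r) (hlam : lam ≠ 0) (hd : 1 ≤ d)
    (hF : IntegrableOn (fun s : ℝ => (1 - cdf F s) ^ (1 / (d : ℝ))) (Set.Ioi 0) volume) :
    ∃ K : ℝ≥0∞, K ≠ ∞ ∧ ∀ L, 0 < L →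
      ∫⁻ ω, chainReward 0 L (p · ω) (r · ω) ∂P ≤ K * ENNReal.ofReal L := by
  obtain ⟨C, hC, hbound⟩ := h.exists_lintegral_exceedance_le hlam hd
  refine ⟨ENNReal.ofReal C * ∫⁻ s in Set.Ioi 0,
    ENNReal.ofReal ((1 - cdf F s) ^ (1 / (d : ℝ))), ?_, fun L hL => ?_⟩
  · refine ENNReal.mul_ne_top (by simp) ?_
    have h0 : ∀ s, 0 ≤ (1 - cdf F s) ^ (1 / (d : ℝ)) := fun s =>
      Real.rpow_nonneg (by linarith [cdf_le_one F s]) _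
    have := (hasFiniteIntegral_iff_ofReal (ae_of_all _ h0)).1 hF.2
    exact this.ne
  have hmeas : Measurable fun q : Ω × ℝ =>
      chainReward 0 L (p · q.1) (exceedanceIndicator q.2 (r · q.1)) := by
    have hr : Measurable fun (q : Ω × ℝ) (i : ℕ) => r i q.1 :=
      measurable_pi_lambda _ fun i => (h.measurable i).comp measurable_fst
    have h1 : Measurable fun q : Ω × ℝ => exceedanceIndicator q.2 fun i => r i q.1 :=
      measurable_exceedanceIndicator.comp (measurable_snd.prodMk hr)
    have h2 : Measurable fun (q : Ω × ℝ) (i : ℕ) => p i q.1 :=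
      measurable_pi_lambda _ fun i => (h.locations.measurable i).comp measurable_fst
    have h3 := Measurable.comp (g := fun q : (ℕ → RewardSpace d) × (ℕ → ℝ) =>
      chainReward 0 L q.1 q.2) (_root_.measurable_chainReward 0 L) (h2.prodMk h1)
    simpa only [Function.comp_def] using h3
  calc ∫⁻ ω, chainReward 0 L (p · ω) (r · ω) ∂P
      ≤ ∫⁻ ω, (∫⁻ s in Set.Ioi 0, chainReward 0 L (p · ω) (exceedanceIndicator s (r · ω))) ∂P :=
        lintegral_mono fun ω => chainReward_le_lintegral_exceedance L _ _
    _ = ∫⁻ s in Set.Ioi 0, ∫⁻ ω, chainReward 0 L (p · ω) (exceedanceIndicator s (r · ω)) ∂P :=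
        lintegral_lintegral_swap hmeas.aemeasurable
    _ ≤ ∫⁻ s in Set.Ioi 0, ENNReal.ofReal (C * L) *
          ENNReal.ofReal ((1 - cdf F s) ^ (1 / (d : ℝ))) := by
        refine lintegral_mono fun s => (hbound L hL s).trans (le_of_eq ?_)
        rw [← ENNReal.ofReal_mul (by positivity), cdf_eq_real,
          ← probReal_compl_eq_one_sub measurableSet_Iic, Set.compl_Iic]
    _ = _ := by
        rw [lintegral_const_mul' _ _ (by simp), ENNReal.ofReal_mul hC]
        ring

end UpperBound

/-! ### Fekete's lemma and the conclusion. -/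

/-- Fekete's lemma for nonnegative, nondecreasing, superadditive functions of a real variable. -/
theorem tendsto_div_of_superadditive {a : ℝ → ℝ≥0∞} (hmono : Monotone a)
    (hsup : ∀ L M, 0 ≤ L → 0 ≤ M → a L + a M ≤ a (L + M)) :
    Tendsto (fun L => a L / ENNReal.ofReal L) atTop
      (𝓝 (⨆ L : Set.Ioi (0 : ℝ), a L / ENNReal.ofReal L)) := by
  have hnat : ∀ (n : ℕ) (M : ℝ), 0 ≤ M → n * a M ≤ a (n * M) := by
    intro n M hM
    induction n with
    | zero => simp
    | succ n ih =>
      push_cast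
      rw [add_mul, add_mul, one_mul, one_mul]
      exact (add_le_add_left ih _).trans (hsup _ _ (by positivity) hM)
  rw [tendsto_order]
  constructor
  · intro b hb
    obtain ⟨⟨M, hM⟩, hbM⟩ := lt_iSup_iff.1 hb
    have hM0 : 0 < M := hM
    -- Fit ⌊L/M⌋ blocks of length `M` into `L`, for an `M` whose ratio exceeds `b`: monotonicity
    -- absorbs the remainder, and the fraction of `L` that is covered tends to 1.
    have hlim : Tendsto (fun L : ℝ => ENNReal.ofReal ((⌊L / M⌋₊ : ℝ) / (L / M)) *
        (a M / ENNReal.ofReal M)) atTop (𝓝 (1 * (a M / ENNReal.ofReal M))) := by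
      refine ENNReal.Tendsto.mul_const ?_ (Or.inl one_ne_zero)
      rw [← ENNReal.ofReal_one]
      exact ENNReal.tendsto_ofReal
        ((tendsto_nat_floor_div_atTop (R := ℝ)).comp (tendsto_id.atTop_div_const hM0))
    rw [one_mul] at hlim
    filter_upwards [hlim.eventually (lt_mem_nhds hbM), eventually_gt_atTop 0] with L hL hL0
    refine hL.trans_le ?_
    rw [ENNReal.ofReal_div_of_pos (by positivity), ENNReal.ofReal_div_of_pos hM0,
      ENNReal.ofReal_natCast]
    have hM' : ENNReal.ofReal M ≠ 0 := by simpa using hM0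
    calc (⌊L / M⌋₊ : ℝ≥0∞) / (ENNReal.ofReal L / ENNReal.ofReal M) * (a M / ENNReal.ofReal M)
        = (⌊L / M⌋₊ * a M) / ENNReal.ofReal L *
            (ENNReal.ofReal M * (ENNReal.ofReal M)⁻¹) := by
          simp only [div_eq_mul_inv]
          rw [ENNReal.mul_inv (Or.inr (by simpa using hM0)) (Or.inr (by simp)), inv_inv]
          ring
      _ = (⌊L / M⌋₊ * a M) / ENNReal.ofReal L := by
          rw [ENNReal.mul_inv_cancel hM' (by simp), mul_one]
      _ ≤ a L / ENNReal.ofReal L := by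
          gcongr
          refine (hnat _ M hM0.le).trans (hmono ?_)
          rw [← le_div_iff₀ hM0]
          exact Nat.floor_le (by positivity)
  · intro b hb
    filter_upwards [eventually_gt_atTop 0] with L hL
    exact (le_iSup (fun L : Set.Ioi (0 : ℝ) => a L / ENNReal.ofReal L) ⟨L, hL⟩).trans_lt hb

theorem mainTheorem12 (d : ℕ) (hd : 2 ≤ d) (v : ℝ) (hv : 0 < v) (lam : ℝ≥0) (hlam : 0 < lam)
    (F : Measure ℝ) [IsProbabilityMeasure F]
    (hF : IntegrableOn (fun s : ℝ => (1 - cdf F s) ^ (1 / (d : ℝ))) (Set.Ioi 0) volume)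
    {Ω : Type*} [MeasurableSpace Ω] (P : Measure Ω) [IsProbabilityMeasure P]
    (p : ℕ → Ω → RewardSpace d) (r : ℕ → Ω → ℝ) (hfield : IsPoissonRewardField P lam F p r) :
    (∀ L : ℝ, 0 < L → AEMeasurable (fun ω => optimalReward v (p · ω) (r · ω) L) P) ∧
    ∃ c : ℝ≥0,
      (⨆ L : Set.Ioi (0 : ℝ),
        (∫⁻ ω, optimalReward v (p · ω) (r · ω) (L : ℝ) ∂P) / ENNReal.ofReal (L : ℝ)) = c ∧
      Tendsto (fun L : ℝ => ∫⁻ ω, optimalMeanReward v (p · ω) (r · ω) L ∂P) atTop (𝓝 (c : ℝ≥0∞)) ∧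
      Tendsto (fun L : ℝ =>
        (∫⁻ ω, optimalReward v (p · ω) (r · ω) L ∂P) / ENNReal.ofReal L) atTop
        (𝓝 (c : ℝ≥0∞)) := by
  have heq : ∀ L : ℝ, 0 < L → ∀ ω, optimalReward v (p · ω) (r · ω) L =
      chainReward 0 L (p · ω) (r · ω) := fun L hL ω => optimalReward_eq_chainReward hv hL _ _
  refine ⟨fun L hL => ?_, ?_⟩
  · simp_rw [heq L hL]
    exact (hfield.measurable_chainReward 0 L).aemeasurable
  set a : ℝ → ℝ≥0∞ := fun L => ∫⁻ ω, chainReward 0 L (p · ω) (r · ω) ∂P with ha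
  have hmono : Monotone a := fun L M hLM =>
    lintegral_mono fun ω => chainReward_mono_length 0 hLM _ _
  have htend := tendsto_div_of_superadditive hmono
    fun L M hL hM => hfield.superadditive hlam.ne' hL hM
  obtain ⟨K, hK, hbound⟩ := hfield.exists_lintegral_chainReward_le hlam.ne' (by omega) hF
  -- Superadditivity alone allows an infinite limit; the linear bound `K`, hence the tail condition
  -- on `F`, rules it out.
  have hfin : (⨆ L : Set.Ioi (0 : ℝ), a L / ENNReal.ofReal L) ≠ ∞ := by
    refine ne_top_of_le_ne_top hK (iSup_le fun L => ?_)
    exact ENNReal.div_le_of_le_mul (hbound L L.2)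
  refine ⟨(⨆ L : Set.Ioi (0 : ℝ), a L / ENNReal.ofReal L).toNNReal, ?_, ?_, ?_⟩
  · rw [ENNReal.coe_toNNReal hfin]
    refine iSup_congr fun L => ?_
    simp_rw [heq L L.2, ha]
  · rw [ENNReal.coe_toNNReal hfin]
    refine htend.congr' ?_
    filter_upwards [eventually_gt_atTop 0] with L hL
    simp_rw [optimalMeanReward, heq L hL, div_eq_mul_inv]
    rw [lintegral_mul_const _ (hfield.measurable_chainReward 0 L)]
  · rw [ENNReal.coe_toNNReal hfin]
    refine htend.congr' ?_
    filter_upwards [eventually_gt_atTop 0] with L hL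
    simp_rw [heq L hL, ha]
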